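/- Let $M$ be a compact simply connected Kähler manifold whose canonical bundle is holomorphically trivial, and let $f$ be a biholomorphic automorphism of $M$ of infinite order. Let $V$ be a finite-dimensional complex vector space, $\Gamma \subset V$ a lattice with a chosen $\mathbb{Z}$-basis $(b_i)$, and let $\deg : \Gamma \to \mathbb{Z}$ be the homomorphism with $\deg b_i = 1$ for all $i$. Let $\Gamma$ act on $M \times V$ by $$\gamma \cdot (z,t) = (f^{\deg \gamma}(z),\, t + \gamma),$$ let $X = (M \times V)/\Gamma$ be the quotient complex manifold, and let $q : M \times V \to X$ be the quotient map. Then: 1. The canonical bundle $K_X$ carries a smooth Hermitian metric $h$ that is flat, i.e. whose curvature form vanishes identically. Its pullback $q^*h$ is a flat smooth Hermitian metric on $K_{M \times V}$ that is invariant under the action of $\Gamma$. 2. The first Chern class of $K_X$ vanishes: $c_1(K_X) = 0$ in the de Rham cohomology group $H^2(X,\mathbb{R})$. That is, for every smooth Hermitian metric on $K_X$ with curvature $\Theta$, the closed form $\frac{i}{2\pi}\Theta$ is exact. 3. $K_X$ is nef, and its numerical dimension is zero: the largest integer $k \ge 0$ with $c_1(K_X)^k \neq 0$ in $H^{2k}(X,\mathbb{R})$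 is $k = 0$. Here $K_X$ is called nef if for every smooth positive real $(1,1)$-form $\eta$ on $X$ and every $\varepsilon > 0$ there is a smooth Hermitian metric on $K_X$ with curvature $i\Theta \ge -\varepsilon\eta$. -/

import Mathlib

open scoped ContDiff Manifold Topology
noncomputable section

/-! ## Differential forms and de Rham cohomology of a complex manifold -/

section ComplexManifold

variable (E : Type*) [NormedAddCommGroup E] [NormedSpace ℂ E]
variable (X : Type*) [TopologicalSpace X] [ChartedSpace E X]

/-- Families of real-valued alternating `k`-forms on the (real) tangent spaces of `X`. -/
def RealForm (k : ℕ) : Type _ :=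
  X → E [⋀^Fin k]→L[ℝ] ℝ

instance RealForm.instAddCommGroup (k : ℕ) : AddCommGroup (RealForm E X k) :=
  inferInstanceAs (AddCommGroup (X → E [⋀^Fin k]→L[ℝ] ℝ))

instance RealForm.instModule (k : ℕ) : Module ℝ (RealForm E X k) :=
  inferInstanceAs (Module ℝ (X → E [⋀^Fin k]→L[ℝ] ℝ))

variable {E X}

/-- The differential of a chart at the point `x`. -/
def chartDeriv (e : OpenPartialHomeomorph X E) (x : X) : E →L[ℂ] E :=
  mfderiv 𝓘(ℂ, E) 𝓘(ℂ, E) e x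

/-- The differential of the inverse of a chart at the point `y`. -/
def chartSymmDeriv (e : OpenPartialHomeomorph X E) (y : E) : E →L[ℂ] E :=
  mfderiv 𝓘(ℂ, E) 𝓘(ℂ, E) e.symm y

/-- The expression of `α` in the chart `e`, that is, the pullback of `α` by `e.symm`. -/
def RealForm.inChart {k : ℕ} (e : OpenPartialHomeomorph X E) (α : RealForm E X k) :
    E → E [⋀^Fin k]→L[ℝ] ℝ :=
  fun y => (α (e.symm y)).compContinuousLinearMap ((chartSymmDeriv e y).restrictScalars ℝ)

/-- A form is smooth if all its expressions in charts are. -/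
def RealForm.IsSmooth {k : ℕ} (α : RealForm E X k) : Prop :=
  ∀ e ∈ atlas E X, ContDiffOn ℝ ∞ (α.inChart e) e.target

/-- The exterior derivative, computed in the preferred chart at each point. -/
def RealForm.d {k : ℕ} (α : RealForm E X k) : RealForm E X (k + 1) :=
  fun x => (extDeriv (α.inChart (chartAt E x)) (chartAt E x x)).compContinuousLinearMap
    ((chartDeriv (chartAt E x) x).restrictScalars ℝ)

theorem RealForm.inChart_add {k : ℕ} (e : OpenPartialHomeomorph X E) (α β : RealForm E X k) :
    (α + β).inChart e = α.inChart e + β.inChart e := rfl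

theorem RealForm.inChart_smul {k : ℕ} (e : OpenPartialHomeomorph X E) (c : ℝ)
    (α : RealForm E X k) : (c • α).inChart e = c • α.inChart e := rfl

theorem RealForm.inChart_zero {k : ℕ} (e : OpenPartialHomeomorph X E) :
    (0 : RealForm E X k).inChart e = 0 := rfl

theorem RealForm.IsSmooth.zero {k : ℕ} : (0 : RealForm E X k).IsSmooth := by
  intro e he
  rw [RealForm.inChart_zero]
  exact contDiffOn_const

theorem RealForm.IsSmooth.add {k : ℕ} {α β : RealForm E X k} (hα : α.IsSmooth)
    (hβ : β.IsSmooth) : (α + β).IsSmooth := by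
  intro e he
  rw [RealForm.inChart_add]
  exact (hα e he).add (hβ e he)

theorem RealForm.IsSmooth.smul {k : ℕ} (c : ℝ) {α : RealForm E X k} (hα : α.IsSmooth) :
    (c • α).IsSmooth := by
  intro e he
  rw [RealForm.inChart_smul]
  exact (hα e he).const_smul c

theorem RealForm.IsSmooth.differentiableAt {k : ℕ} {α : RealForm E X k} (hα : α.IsSmooth)
    (x : X) : DifferentiableAt ℝ (α.inChart (chartAt E x)) (chartAt E x x) :=
  ((hα _ (chart_mem_atlas E x)).contDiffAt
    ((chartAt E x).open_target.mem_nhds (mem_chart_target E x))).differentiableAt (by simp)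

theorem RealForm.d_zero {k : ℕ} : (0 : RealForm E X k).d = 0 := by
  funext x
  have : extDeriv (0 : E → E [⋀^Fin k]→L[ℝ] ℝ) (chartAt E x x) = 0 := by
    have h := extDeriv_smul (𝕜 := ℝ) (0 : ℝ) (0 : E → E [⋀^Fin k]→L[ℝ] ℝ) (x := chartAt E x x)
    simpa using h
  rw [RealForm.d, RealForm.inChart_zero, this]
  rfl

theorem RealForm.d_add {k : ℕ} {α β : RealForm E X k} (hα : α.IsSmooth) (hβ : β.IsSmooth) :
    (α + β).d = α.d + β.d := by
  funext x
  rw [RealForm.d, RealForm.inChart_add,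
    extDeriv_add (hα.differentiableAt x) (hβ.differentiableAt x)]
  rfl

theorem RealForm.d_smul {k : ℕ} (c : ℝ) (α : RealForm E X k) : (c • α).d = c • α.d := by
  funext x
  rw [RealForm.d, RealForm.inChart_smul, extDeriv_smul]
  rfl

variable (E X)

/-- Smooth closed `k`-forms. -/
def closedForms (k : ℕ) : Submodule ℝ (RealForm E X k) where
  carrier := {α | α.IsSmooth ∧ α.d = 0}
  zero_mem' := ⟨.zero, RealForm.d_zero⟩
  add_mem' := fun ha hb => ⟨ha.1.add hb.1, by
    rw [RealForm.d_add ha.1 hb.1, ha.2, hb.2, add_zero]⟩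
  smul_mem' := fun c _ ha => ⟨ha.1.smul c, by rw [RealForm.d_smul, ha.2, smul_zero]⟩

/-- Exact `k`-forms: exterior derivatives of smooth forms (only `0` when `k = 0`). -/
def exactForms : (k : ℕ) → Submodule ℝ (RealForm E X k)
  | 0 => ⊥
  | k + 1 =>
    { carrier := {α | ∃ β : RealForm E X k, β.IsSmooth ∧ β.d = α}
      zero_mem' := ⟨0, .zero, RealForm.d_zero⟩
      add_mem' := by
        rintro _ _ ⟨a, ha, rfl⟩ ⟨b, hb, rfl⟩
        exact ⟨a + b, ha.add hb, RealForm.d_add ha hb⟩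
      smul_mem' := by
        rintro c _ ⟨a, ha, rfl⟩
        exact ⟨c • a, ha.smul c, RealForm.d_smul c a⟩ }

/-- De Rham cohomology `H^k(X, ℝ)`: closed forms modulo exact forms. -/
abbrev DeRhamCohomology (k : ℕ) : Type _ :=
  closedForms E X k ⧸ (exactForms E X k).comap (closedForms E X k).subtype

variable {E X}

/-- The form `α` is closed and its cohomology class is `c`. -/
def RealForm.Represents {k : ℕ} (α : RealForm E X k) (c : DeRhamCohomology E X k) : Prop :=
  ∃ hα : α ∈ closedForms E X k, Submodule.Quotient.mk ⟨α, hα⟩ = c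

theorem pairProd_aux {W : Type*} {k : ℕ} (v : Fin (k * 2) → W) (i l : Fin k) (j : Fin 2) (z : W) :
    (fun j' => Function.update v (finProdFinEquiv (i, j)) z (finProdFinEquiv (l, j'))) =
      if i = l then Function.update (fun j' => v (finProdFinEquiv (l, j'))) j z
      else fun j' => v (finProdFinEquiv (l, j')) := by
  funext j'
  split_ifs with h
  · subst h
    simp [Function.update_apply]
  · rw [Function.update_of_ne]
    simpa using fun h' => (h h'.symm).elim

/-- The multilinear map `(v₀, v₁, …, v₂ₖ₋₁) ↦ ∏ᵢ η(v₂ᵢ, v₂ᵢ₊₁)`. -/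
def pairProd {W : Type*} [AddCommGroup W] [Module ℝ W] [TopologicalSpace W]
    (η : W [⋀^Fin 2]→L[ℝ] ℝ) (k : ℕ) :
    ContinuousMultilinearMap ℝ (fun _ : Fin (k * 2) => W) ℝ where
  toFun v := ∏ i : Fin k, η fun j => v (finProdFinEquiv (i, j))
  map_update_add' := by
    intro dec v a x y
    obtain ⟨⟨i, j⟩, rfl⟩ := finProdFinEquiv.surjective a
    rw [Subsingleton.elim dec (instDecidableEqFin _)]
    simp only [pairProd_aux, Fintype.prod_eq_mul_prod_compl i]
    have h : ∀ z, ∏ l ∈ ({i}ᶜ : Finset (Fin k)), η (if i = l then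
        Function.update (fun j' => v (finProdFinEquiv (l, j'))) j z else
        fun j' => v (finProdFinEquiv (l, j'))) =
        ∏ l ∈ ({i}ᶜ : Finset (Fin k)), η fun j' => v (finProdFinEquiv (l, j')) := fun z =>
      Finset.prod_congr rfl fun l hl => by
        rw [if_neg]
        rintro rfl
        simp at hl
    simp only [h, if_true, η.map_update_add, add_mul]
  map_update_smul' := by
    intro dec v a c x
    obtain ⟨⟨i, j⟩, rfl⟩ := finProdFinEquiv.surjective a
    rw [Subsingleton.elim dec (instDecidableEqFin _)]
    simp only [pairProd_aux, Fintype.prod_eq_mul_prod_compl i]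
    have h : ∀ z, ∏ l ∈ ({i}ᶜ : Finset (Fin k)), η (if i = l then
        Function.update (fun j' => v (finProdFinEquiv (l, j'))) j z else
        fun j' => v (finProdFinEquiv (l, j'))) =
        ∏ l ∈ ({i}ᶜ : Finset (Fin k)), η fun j' => v (finProdFinEquiv (l, j')) := fun z =>
      Finset.prod_congr rfl fun l hl => by
        rw [if_neg]
        rintro rfl
        simp at hl
    simp only [h, if_true, η.map_update_smul, smul_eq_mul, mul_assoc]
  cont := by
    refine continuous_finsetProd _ fun i _ => η.cont.comp ?_
    fun_prop

/-- The `k`-th exterior power `η ∧ ⋯ ∧ η` of a real `2`-form. -/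
def wedgePow {W : Type*} [AddCommGroup W] [Module ℝ W] [TopologicalSpace W]
    (η : W [⋀^Fin 2]→L[ℝ] ℝ) (k : ℕ) : W [⋀^Fin (k * 2)]→L[ℝ] ℝ :=
  ((1 / 2 : ℝ) ^ k) • ContinuousMultilinearMap.alternatization (pairProd η k)


/-! ## Kähler manifolds -/

/-- A positive real `(1,1)`-form: a real `2`-form `η` with `η(iv, iw) = η(v, w)` and
`η(v, iv) > 0` for `v ≠ 0`. -/
structure RealForm.IsPositive (η : RealForm E X 2) : Prop where
  invariant : ∀ x v w, η x ![Complex.I • v, Complex.I • w] = η x ![v, w]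
  pos : ∀ x v, v ≠ 0 → 0 < η x ![v, Complex.I • v]

variable (E X)

/-- `X` carries a Kähler metric, given by its Kähler form. -/
def IsKaehler : Prop :=
  ∃ η : RealForm E X 2, η ∈ closedForms E X 2 ∧ η.IsPositive

/-! ## The canonical bundle -/

/-- The fibre at any point `x` of the canonical bundle of a manifold modelled on `E`: alternating
`ℂ`-multilinear forms of degree `dim E` on the tangent space at `x`, which is `E` itself. -/
abbrev CanonicalFiber : Type _ :=
  E [⋀^Fin (Module.finrank ℂ E)]→ₗ[ℂ] ℂ

variable {E X}

/-- Pullback `F^* α` at `x` of a point `α` of the canonical bundle over `F x`. -/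
def canonicalPullback {Y : Type*} [TopologicalSpace Y] [ChartedSpace E Y] (F : X → Y) (x : X)
    (α : CanonicalFiber E) : CanonicalFiber E :=
  α.compLinearMap (mfderiv 𝓘(ℂ, E) 𝓘(ℂ, E) F x : E →L[ℂ] E).toLinearMap

variable [FiniteDimensional ℂ E]

variable (E) in
/-- The form `dz₁ ∧ ⋯ ∧ dzₙ` on the model space `E`, for the linear coordinates of a fixed basis. -/
def standardVolume : CanonicalFiber E :=
  (Module.finBasis ℂ E).det

/-- The local frame `dz₁ ∧ ⋯ ∧ dzₙ` of the canonical bundle over the domain of the chart `e`. -/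
def canonicalFrame (e : OpenPartialHomeomorph X E) (x : X) : CanonicalFiber E :=
  (standardVolume E).compLinearMap (chartDeriv e x).toLinearMap

/-- The coefficient of `σ` in a chart `e`, namely the function `s` such that `σ` is
`s dz₁ ∧ ⋯ ∧ dzₙ` in this chart. -/
def canonicalCoeff (e : OpenPartialHomeomorph X E) (σ : X → CanonicalFiber E) (y : E) : ℂ :=
  σ (e.symm y) fun i => chartSymmDeriv e y (Module.finBasis ℂ E i)

variable (E X)

/-- The canonical bundle is holomorphically trivial: it has a nowhere vanishing holomorphic
section. -/
def HasTrivialCanonicalBundle : Prop :=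
  ∃ σ : X → CanonicalFiber E,
    (∀ e ∈ atlas E X, ContDiffOn ℂ ω (canonicalCoeff e σ) e.target) ∧ ∀ x, σ x ≠ 0

/-- A smooth Hermitian metric on the canonical bundle of `X`. -/
structure CanonicalMetric where
  /-- the Hermitian product on the fibre at each point -/
  inner : X → CanonicalFiber E →ₗ[ℂ] CanonicalFiber E →ₗ⋆[ℂ] ℂ
  conj_symm : ∀ x α β, starRingEnd ℂ (inner x α β) = inner x β α
  pos : ∀ x α, α ≠ 0 → 0 < (inner x α α).re
  smooth : ∀ e ∈ atlas E X, ContDiffOn ℝ ∞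
    (fun y => (inner (e.symm y) (canonicalFrame e (e.symm y))
      (canonicalFrame e (e.symm y))).re) e.target

variable {E X}

/-- A map `F`, compatible with two Hermitian metrics: `F^*` is isometric on canonical bundles. -/
def CanonicalMetric.IsPullback {Y : Type*} [TopologicalSpace Y] [ChartedSpace E Y]
    (h : CanonicalMetric E X) (F : X → Y) (h' : CanonicalMetric E Y) : Prop :=
  ∀ x α β, h.inner x (canonicalPullback F x α) (canonicalPullback F x β) = h'.inner (F x) α β

/-- The real `(1,1)`-form `i ∂∂̄ u = - (1/2) d (du ∘ J)` of a function on `E`. -/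
def iddbar (u : E → ℝ) (y : E) : E [⋀^Fin 2]→L[ℝ] ℝ :=
  (-(1 / 2) : ℝ) • extDeriv (fun z => ContinuousAlternatingMap.ofSubsingleton ℝ E ℝ (0 : Fin 1)
    ((fderiv ℝ u z).comp ((Complex.I • ContinuousLinearMap.id ℂ E).restrictScalars ℝ))) y

/-- The logarithm of the squared norm of the local frame `dz₁ ∧ ⋯ ∧ dzₙ` in a chart. -/
def CanonicalMetric.logNorm (h : CanonicalMetric E X) (e : OpenPartialHomeomorph X E) (y : E) : ℝ :=
  Real.log (h.inner (e.symm y) (canonicalFrame e (e.symm y)) (canonicalFrame e (e.symm y))).re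

/-- The real curvature form `iΘ = - i ∂∂̄ log |dz₁ ∧ ⋯ ∧ dzₙ|²` of a Hermitian metric on the
canonical bundle. -/
def CanonicalMetric.curvature (h : CanonicalMetric E X) : RealForm E X 2 :=
  fun x => -(iddbar (h.logNorm (chartAt E x)) (chartAt E x x)).compContinuousLinearMap
    ((chartDeriv (chartAt E x) x).restrictScalars ℝ)

/-- The metric is flat: its curvature vanishes identically. -/
def CanonicalMetric.IsFlat (h : CanonicalMetric E X) : Prop :=
  h.curvature = 0

/-- The Chern form `(i / 2π) Θ` of a Hermitian metric on the canonical bundle. -/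
def CanonicalMetric.chernForm (h : CanonicalMetric E X) : RealForm E X 2 :=
  (1 / (2 * Real.pi)) • h.curvature

/-- `c` is the real first Chern class of the canonical bundle: it is the class of the Chern form
of any smooth Hermitian metric on it. -/
def IsCanonicalChernClass (c : DeRhamCohomology E X 2) : Prop :=
  Nonempty (CanonicalMetric E X) ∧ ∀ h : CanonicalMetric E X, h.chernForm.Represents c

/-- `c` is the `k`-th power in `H^{2k}(X, ℝ)` of the first Chern class of the canonical bundle: it
is the class of the `k`-th exterior power of the Chern form of any smooth Hermitian metric. -/
def IsCanonicalChernPower (k : ℕ) (c : DeRhamCohomology E X (k * 2)) : Prop :=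
  Nonempty (CanonicalMetric E X) ∧ ∀ h : CanonicalMetric E X,
    RealForm.Represents (fun x => wedgePow (h.chernForm x) k) c

variable (E X)

/-- The canonical bundle is nef: for every positive form `η` and every `ε > 0` it has a smooth
Hermitian metric whose curvature form is at least `- ε η`. -/
def IsCanonicalNef : Prop :=
  ∀ η : RealForm E X 2, η.IsSmooth → η.IsPositive → ∀ ε : ℝ, 0 < ε →
    ∃ h : CanonicalMetric E X, ∀ x v,
      -ε * η x ![v, Complex.I • v] ≤ h.curvature x ![v, Complex.I • v]

/-- The canonical bundle `K` is nef of numerical dimension `ν`: the largest `k` such that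
`c₁(K)^k ≠ 0` in `H^{2k}(X, ℝ)` is `ν`. -/
def HasCanonicalNumericalDimension (ν : ℕ) : Prop :=
  IsCanonicalNef E X ∧
    IsGreatest {k | ∃ c : DeRhamCohomology E X (k * 2), IsCanonicalChernPower k c ∧ c ≠ 0} ν

end ComplexManifold

/-! ## Quotients by free properly discontinuous holomorphic actions -/

theorem eventually_section_eq_vadd {N Q G : Type*} [TopologicalSpace N] [TopologicalSpace Q]
    [AddGroup G] [AddAction G N] {π : N → Q} (hcov : IsAddQuotientCoveringMap π G)
    (l : OpenPartialHomeomorph Q N) (hl : l.symm = π) (p : N) (hp : π p ∈ l.source) :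
    ∃ g : G, ∀ᶠ p' in 𝓝 p, l (π p') = g +ᵥ p' := by
  have hsec : ∀ x ∈ l.source, π (l x) = x := fun x hx => by rw [← hl]; exact l.left_inv hx
  obtain ⟨g, hg⟩ := hcov.apply_eq_iff_mem_orbit.mp (hsec _ hp)
  have hg : g +ᵥ p = l (π p) := hg
  have := hcov.toContinuousConstVAdd
  obtain ⟨U, hU, hdisj⟩ := hcov.disjoint (l (π p))
  have hπ : ContinuousAt π p := hcov.isCoveringMap.continuous.continuousAt
  have h1 : ∀ᶠ p' in 𝓝 p, l (π p') ∈ U :=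
    ((l.continuousAt hp).comp (f := π) hπ).eventually hU
  have h2 : ∀ᶠ p' in 𝓝 p, g +ᵥ p' ∈ U :=
    (continuous_const_vadd g).continuousAt.eventually
      (show U ∈ 𝓝 (g +ᵥ p) by rw [hg]; exact hU)
  have h3 : ∀ᶠ p' in 𝓝 p, π p' ∈ l.source := hπ.eventually (l.open_source.mem_nhds hp)
  refine ⟨g, ?_⟩
  filter_upwards [h1, h2, h3] with p' h1 h2 h3
  obtain ⟨k, hk⟩ := hcov.apply_eq_iff_mem_orbit.mp (hsec _ h3)
  have hk : k +ᵥ p' = l (π p') := hk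
  have hz : k + -g = 0 := hdisj (k + -g) ⟨l (π p'), ⟨g +ᵥ p', h2, by
    simp only [add_vadd, neg_vadd_vadd, hk]⟩, h1⟩
  rw [← hk, add_neg_eq_zero.mp hz]

theorem quotient_isManifold {E : Type*} [NormedAddCommGroup E] [NormedSpace ℂ E]
    {N G : Type*} [TopologicalSpace N] [T2Space N] [LocallyCompactSpace N] [ChartedSpace E N]
    [IsManifold 𝓘(ℂ, E) ω N] [AddGroup G] [AddAction G N] [ProperlyDiscontinuousVAdd G N]
    [ContinuousConstVAdd G N] [IsCancelVAdd G N]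
    (hG : ∀ g : G, ContMDiff 𝓘(ℂ, E) 𝓘(ℂ, E) ω (fun p : N => g +ᵥ p)) :
    IsManifold 𝓘(ℂ, E) ω (AddAction.orbitRel.Quotient G N) := by
  have hcov := isAddQuotientCoveringMap_quotientMk_of_properlyDiscontinuousVAdd (E := N) (G := G)
  have hloc := hcov.isCoveringMap.isLocalHomeomorph
  have key : ∀ p q : N, ContDiffOn ℂ ω
      ((hloc.localInverseAt p ≫ₕ chartAt E p).symm ≫ₕ (hloc.localInverseAt q ≫ₕ chartAt E q))
      ((hloc.localInverseAt p ≫ₕ chartAt E p).symm ≫ₕ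
        (hloc.localInverseAt q ≫ₕ chartAt E q)).source := by
    intro p q y hy
    simp only [OpenPartialHomeomorph.trans_symm_eq_symm_trans_symm,
      OpenPartialHomeomorph.trans_source, OpenPartialHomeomorph.symm_source,
      Set.mem_inter_iff, Set.mem_preimage, OpenPartialHomeomorph.coe_trans,
      Function.comp_apply, IsLocalHomeomorph.localInverseAt_symm] at hy
    obtain ⟨⟨hy1, hy2⟩, hy3, hy4⟩ := hy
    obtain ⟨g, hg⟩ := eventually_section_eq_vadd hcov (hloc.localInverseAt q)
      (hloc.localInverseAt_symm q) _ hy3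
    have hc : ContinuousAt (chartAt E p).symm y := (chartAt E p).symm.continuousAt hy1
    have hval := hg.self_of_nhds
    have h1 : ContMDiffAt 𝓘(ℂ, E) 𝓘(ℂ, E) ω (chartAt E p).symm y :=
      contMDiffOn_chart_symm.contMDiffAt ((chartAt E p).open_target.mem_nhds hy1)
    have h3 : ContMDiffAt 𝓘(ℂ, E) 𝓘(ℂ, E) ω (chartAt E q) (g +ᵥ (chartAt E p).symm y) :=
      contMDiffOn_chart.contMDiffAt ((chartAt E q).open_source.mem_nhds (by rw [← hval]; exact hy4))
    have h : ContMDiffAt 𝓘(ℂ, E) 𝓘(ℂ, E) ω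
        (fun z => chartAt E q (g +ᵥ (chartAt E p).symm z)) y :=
      h3.comp y (((hG g).contMDiffAt (x := (chartAt E p).symm y)).comp y h1)
    refine (h.contDiffAt.congr_of_eventuallyEq ?_).contDiffWithinAt
    filter_upwards [hc.eventually hg] with z hz
    simp only [OpenPartialHomeomorph.trans_symm_eq_symm_trans_symm,
      OpenPartialHomeomorph.coe_trans, Function.comp_apply,
      IsLocalHomeomorph.localInverseAt_symm, hz]
  apply isManifold_of_contDiffOn
  rintro _ _ ⟨a, rfl⟩ ⟨b, rfl⟩
  simpa using key _ _

/-! ## The quotient `X(M, V / Γ)` -/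

section Suspension

variable {E : Type*} [NormedAddCommGroup E] [NormedSpace ℂ E]
variable {M : Type*} [TopologicalSpace M] [ChartedSpace E M]
variable {V : Type*} [NormedAddCommGroup V] [NormedSpace ℂ V]
variable {Γ : Submodule ℤ V} {ι : Type*}

/-- The additive map `deg : Γ → ℤ` taking the value `1` on each generator `b i` of the lattice. -/
def latticeDegree (b : Module.Basis ι ℤ Γ) : Γ →ₗ[ℤ] ℤ :=
  b.constr ℤ fun _ => (1 : ℤ)

/-- The representation `Γ → Aut M` sending each generator `b i` to `f`. -/
def monodromy (f : M ≃ₘ^ω⟮𝓘(ℂ, E), 𝓘(ℂ, E)⟯ M) (b : Module.Basis ι ℤ Γ) (γ : Γ) :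
    Equiv.Perm M :=
  (f.toEquiv : Equiv.Perm M) ^ latticeDegree b γ

/-- The product `M × V`, together with the data that determine the action of `Γ` on it. -/
@[nolint unusedArguments]
def SuspensionCover (_f : M ≃ₘ^ω⟮𝓘(ℂ, E), 𝓘(ℂ, E)⟯ M) (_b : Module.Basis ι ℤ Γ) : Type _ :=
  M × V

variable (f : M ≃ₘ^ω⟮𝓘(ℂ, E), 𝓘(ℂ, E)⟯ M) (b : Module.Basis ι ℤ Γ)

instance : TopologicalSpace (SuspensionCover f b) :=
  inferInstanceAs (TopologicalSpace (M × V))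

instance [T2Space M] : T2Space (SuspensionCover f b) :=
  inferInstanceAs (T2Space (M × V))

instance [CompactSpace M] [T2Space M] [FiniteDimensional ℂ V] :
    LocallyCompactSpace (SuspensionCover f b) :=
  haveI := FiniteDimensional.proper_rclike ℂ V
  inferInstanceAs (LocallyCompactSpace (M × V))

instance : ChartedSpace (E × V) (SuspensionCover f b) :=
  inferInstanceAs (ChartedSpace (ModelProd E V) (M × V))

instance [IsManifold 𝓘(ℂ, E) ω M] : IsManifold 𝓘(ℂ, E × V) ω (SuspensionCover f b) := by
  rw [modelWithCornersSelf_prod]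
  exact inferInstanceAs (IsManifold (𝓘(ℂ, E).prod 𝓘(ℂ, V)) ω (M × V))

/-- The action `γ · (z, t) = (γ(z), t + γ)` of the lattice `Γ` on `M × V`. -/
instance : AddAction Γ (SuspensionCover f b) where
  vadd γ p := ((monodromy f b γ p.1, p.2 + (γ : V)) : M × V)
  zero_vadd p := by
    show ((monodromy f b 0 p.1, p.2 + ((0 : Γ) : V)) : M × V) = p
    simp only [monodromy, map_zero, zpow_zero, Equiv.Perm.one_apply, Submodule.coe_zero, add_zero]
    rfl
  add_vadd γ δ p := by
    show ((monodromy f b (γ + δ) p.1, p.2 + ((γ + δ : Γ) : V)) : M × V) =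
      (monodromy f b γ (monodromy f b δ p.1), p.2 + (δ : V) + (γ : V))
    simp only [monodromy, map_add, zpow_add, Equiv.Perm.mul_apply, Submodule.coe_add]
    congr 1
    abel

set_option linter.unusedSectionVars false in
theorem contMDiff_monodromy (γ : Γ) :
    ContMDiff 𝓘(ℂ, E) 𝓘(ℂ, E) ω (monodromy f b γ) := by
  have hpow : ∀ (g : Equiv.Perm M), ContMDiff 𝓘(ℂ, E) 𝓘(ℂ, E) ω g →
      ∀ n : ℕ, ContMDiff 𝓘(ℂ, E) 𝓘(ℂ, E) ω (g ^ n : Equiv.Perm M) := by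
    intro g hg n
    induction n with
    | zero => exact contMDiff_id
    | succ n ih =>
      rw [pow_succ]
      exact ih.comp hg
  unfold monodromy
  obtain ⟨n, hn | hn⟩ := (latticeDegree b γ).eq_nat_or_neg
  · rw [hn, zpow_natCast]
    exact hpow _ f.contMDiff n
  · rw [hn, zpow_neg, zpow_natCast, ← inv_pow]
    exact hpow _ f.symm.contMDiff n

theorem contMDiff_suspension_vadd (γ : Γ) :
    ContMDiff 𝓘(ℂ, E × V) 𝓘(ℂ, E × V) ω (fun p : SuspensionCover f b => γ +ᵥ p) := by
  rw [modelWithCornersSelf_prod]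
  have h : ContMDiff (𝓘(ℂ, E).prod 𝓘(ℂ, V)) (𝓘(ℂ, E).prod 𝓘(ℂ, V)) ω
      (Prod.map (monodromy f b γ) (fun t : V => t + (γ : V))) :=
    (contMDiff_monodromy f b γ).prodMap (contDiff_id.add contDiff_const).contMDiff
  exact h

instance : ContinuousConstVAdd Γ (SuspensionCover f b) :=
  ⟨fun γ => (contMDiff_suspension_vadd f b γ).continuous⟩

instance : IsCancelVAdd Γ (SuspensionCover f b) :=
  isCancelVAdd_iff_eq_zero_of_vadd_eq.mpr fun γ p h => by
    have h2 : p.2 + (γ : V) = p.2 := congrArg Prod.snd h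
    simpa using h2

open scoped Pointwise in
theorem finite_lattice_inter [FiniteDimensional ℂ V] [DiscreteTopology Γ] {K L : Set V} (hK : IsCompact K)
    (hL : IsCompact L) : ((L - K) ∩ (Γ : Set V)).Finite := by
  have := FiniteDimensional.proper_rclike ℂ V
  have hLK : IsCompact (L - K) := by
    rw [← Set.sub_image_prod]
    exact (hL.prod hK).image continuous_sub
  exact Metric.finite_isBounded_inter_isClosed DiscreteTopology.isDiscrete hLK.isBounded
    (AddSubgroup.isClosed_of_discrete (H := Γ.toAddSubgroup))

instance [FiniteDimensional ℂ V] [DiscreteTopology Γ] :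
    ProperlyDiscontinuousVAdd Γ (SuspensionCover f b) where
  finite_disjoint_inter_image := by
    intro K L hK hL
    have hK' : IsCompact (Prod.snd '' (K : Set (M × V))) :=
      IsCompact.image (X := M × V) hK continuous_snd
    have hL' : IsCompact (Prod.snd '' (L : Set (M × V))) :=
      IsCompact.image (X := M × V) hL continuous_snd
    refine Set.Finite.of_finite_image (f := ((↑) : Γ → V))
      ((finite_lattice_inter (Γ := Γ) hK' hL').subset ?_) Subtype.val_injective.injOn
    rintro _ ⟨γ, ⟨_, ⟨p, hp, rfl⟩, hpL⟩, rfl⟩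
    exact ⟨⟨_, ⟨_, hpL, rfl⟩, _, ⟨p, hp, rfl⟩, add_sub_cancel_left p.2 (γ : V)⟩, γ.2⟩

/-- The manifold `X(M, V / Γ) = (M × V) / Γ`. -/
abbrev Suspension : Type _ :=
  AddAction.orbitRel.Quotient Γ (SuspensionCover f b)

/-- The quotient map `q : M × V → X`. -/
def suspensionMk (p : SuspensionCover f b) : Suspension f b :=
  Quotient.mk _ p


/-- The complex manifold structure on the quotient `X(M, V / Γ)`. -/
instance [IsManifold 𝓘(ℂ, E) ω M] [CompactSpace M] [T2Space M] [FiniteDimensional ℂ V]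
    [DiscreteTopology Γ] : IsManifold 𝓘(ℂ, E × V) ω (Suspension f b) :=
  quotient_isManifold (contMDiff_suspension_vadd f b)

end Suspension

end

/-! Let `σ` be a nowhere vanishing holomorphic section of the canonical bundle of `M`. For an
automorphism `F` the quotient `F^* σ / σ` is a holomorphic function on a compact connected manifold,
hence a constant `μ` (`exists_scalesAt_of_compactSpace`). An automorphism preserves total volume, so
`|μ| = 1`. This is proved by estimates in finitely many charts: `|μ|²` is bounded below by a
positive constant that does not depend on `F` (`exists_pos_le_normSq_of_scalesAt`), and applying the
bound to all iterates of `F` and of its inverse leaves only `|μ| = 1` (`normSq_eq_one_of_scalesAt`).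

Hence `|σ|²` is invariant under the monodromy, and the metric on the canonical bundle of `M × V` for
which `σ ∧ dt` has norm one is invariant under `Γ`. It is flat, because in each chart it is locally
the squared modulus of a nonvanishing holomorphic function, whose logarithm is pluriharmonic. By
invariance it descends to a flat metric on `X` (`exists_density_quotient`).

The rest follows from this one metric. Two metrics differ by the exponential of a global function,
so their curvatures differ by an exact form (`curvature_eq_add`); every Chern form is therefore
exact. The flat metric satisfies every nefness inequality and makes all positive powers of the class
vanish, while the zeroth power is the constant `1`.

Tangent spaces are identified with `E` through the preferred chart at each point, which jumps from
point to point. Weights, Jacobians and coefficients of forms in these identifications need not be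
continuous; only combinations corrected by chart Jacobians are. -/

set_option linter.unusedSectionVars false

/-! ## Transition maps and naturality of the exterior derivative -/

section ComplexCharts

variable {E : Type*} [NormedAddCommGroup E] [NormedSpace ℂ E]
variable {X : Type*} [TopologicalSpace X] [ChartedSpace E X] [IsManifold 𝓘(ℂ, E) ω X]

theorem contMDiffAt_of_mem_atlas {e : OpenPartialHomeomorph X E} (he : e ∈ atlas E X) {x : X}
    (hx : x ∈ e.source) : ContMDiffAt 𝓘(ℂ, E) 𝓘(ℂ, E) ω e x :=
  (contMDiffOn_of_mem_maximalAtlas (IsManifold.subset_maximalAtlas he)).contMDiffAt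
    (e.open_source.mem_nhds hx)

theorem contMDiffAt_symm_of_mem_atlas {e : OpenPartialHomeomorph X E} (he : e ∈ atlas E X) {y : E}
    (hy : y ∈ e.target) : ContMDiffAt 𝓘(ℂ, E) 𝓘(ℂ, E) ω e.symm y :=
  (contMDiffOn_symm_of_mem_maximalAtlas (IsManifold.subset_maximalAtlas he)).contMDiffAt
    (e.open_target.mem_nhds hy)

theorem mdifferentiableAt_of_mem_atlas {e : OpenPartialHomeomorph X E} (he : e ∈ atlas E X) {x : X}
    (hx : x ∈ e.source) : MDifferentiableAt 𝓘(ℂ, E) 𝓘(ℂ, E) e x :=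
  (contMDiffAt_of_mem_atlas he hx).mdifferentiableAt (by simp)

theorem mdifferentiableAt_symm_of_mem_atlas {e : OpenPartialHomeomorph X E} (he : e ∈ atlas E X)
    {y : E} (hy : y ∈ e.target) : MDifferentiableAt 𝓘(ℂ, E) 𝓘(ℂ, E) e.symm y :=
  (contMDiffAt_symm_of_mem_atlas he hy).mdifferentiableAt (by simp)

theorem contDiffAt_transition {e e' : OpenPartialHomeomorph X E} (he : e ∈ atlas E X)
    (he' : e' ∈ atlas E X) {y : E} (hy : y ∈ e.target) (hy' : e.symm y ∈ e'.source) :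
    ContDiffAt ℂ ω (e' ∘ e.symm) y :=
  ((contMDiffAt_of_mem_atlas he' hy').comp y (contMDiffAt_symm_of_mem_atlas he hy)).contDiffAt

theorem contDiffAt_real_transition {e e' : OpenPartialHomeomorph X E} (he : e ∈ atlas E X)
    (he' : e' ∈ atlas E X) {y : E} (hy : y ∈ e.target) (hy' : e.symm y ∈ e'.source) :
    ContDiffAt ℝ ω (e' ∘ e.symm) y :=
  (contDiffAt_transition he he' hy hy').restrict_scalars ℝ

theorem eventually_mem_transition_source {e e' : OpenPartialHomeomorph X E} {y : E}
    (hy : y ∈ e.target) (hy' : e.symm y ∈ e'.source) :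
    ∀ᶠ z in 𝓝 y, z ∈ e.target ∧ e.symm z ∈ e'.source :=
  (e.open_target.eventually_mem hy).and
    ((e.symm.continuousAt hy).eventually (e'.open_source.eventually_mem hy'))

theorem chartDeriv_comp_chartSymmDeriv {e e' : OpenPartialHomeomorph X E} (he : e ∈ atlas E X)
    (he' : e' ∈ atlas E X) {y : E} (hy : y ∈ e.target) (hy' : e.symm y ∈ e'.source) :
    (chartDeriv e' (e.symm y)).comp (chartSymmDeriv e y) = fderiv ℂ (e' ∘ e.symm) y := by
  have h := mfderiv_comp (I := 𝓘(ℂ, E)) (I' := 𝓘(ℂ, E)) (I'' := 𝓘(ℂ, E)) y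
    (mdifferentiableAt_of_mem_atlas he' hy') (mdifferentiableAt_symm_of_mem_atlas he hy)
  rw [mfderiv_eq_fderiv] at h
  exact h.symm

theorem chartSymmDeriv_eq_comp {e e' : OpenPartialHomeomorph X E} (he : e ∈ atlas E X)
    (he' : e' ∈ atlas E X) {y : E} (hy : y ∈ e.target) (hy' : e.symm y ∈ e'.source) :
    chartSymmDeriv e y =
      (chartSymmDeriv e' (e' (e.symm y))).comp (fderiv ℂ (e' ∘ e.symm) y) := by
  have h := mfderiv_comp (I := 𝓘(ℂ, E)) (I' := 𝓘(ℂ, E)) (I'' := 𝓘(ℂ, E)) y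
    (g := e'.symm) (f := e' ∘ e.symm)
    (mdifferentiableAt_symm_of_mem_atlas he' (e'.map_source hy'))
    ((contDiffAt_transition he he' hy hy').differentiableAt (by simp)).mdifferentiableAt
  rw [mfderiv_eq_fderiv] at h
  refine Eq.trans ?_ h
  refine Filter.EventuallyEq.mfderiv_eq ?_
  filter_upwards [eventually_mem_transition_source hy hy'] with z hz
  exact (e'.left_inv hz.2).symm

theorem restrictScalars_fderiv_transition {e e' : OpenPartialHomeomorph X E} (he : e ∈ atlas E X)
    (he' : e' ∈ atlas E X) {y : E} (hy : y ∈ e.target) (hy' : e.symm y ∈ e'.source) :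
    (fderiv ℂ (e' ∘ e.symm) y).restrictScalars ℝ = fderiv ℝ (e' ∘ e.symm) y :=
  (((contDiffAt_transition he he' hy hy').differentiableAt (by simp)).fderiv_restrictScalars ℝ).symm

namespace RealForm

variable {k : ℕ}

theorem inChart_apply_transition {e e' : OpenPartialHomeomorph X E} (he : e ∈ atlas E X)
    (he' : e' ∈ atlas E X) {y : E} (hy : y ∈ e.target) (hy' : e.symm y ∈ e'.source)
    (α : RealForm E X k) :
    α.inChart e y =
      (α.inChart e' ((e' ∘ e.symm) y)).compContinuousLinearMap (fderiv ℝ (e' ∘ e.symm) y) := by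
  rw [← restrictScalars_fderiv_transition he he' hy hy', inChart, inChart,
    chartSymmDeriv_eq_comp he he' hy hy', Function.comp_apply, e'.left_inv hy']
  rfl

theorem IsSmooth.inChart_contDiffAt {α : RealForm E X k} (hα : α.IsSmooth)
    {e : OpenPartialHomeomorph X E} (he : e ∈ atlas E X) {y : E} (hy : y ∈ e.target) :
    ContDiffAt ℝ ∞ (α.inChart e) y :=
  (hα e he).contDiffAt (e.open_target.mem_nhds hy)

/-- The definition of `RealForm.d` changes chart with the point. Naturality of `extDeriv` under
transition maps shows that one fixed chart gives the same result near a point, which is what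
smoothness of `α.d` and `d ∘ d = 0` require. -/
theorem IsSmooth.inChart_d {α : RealForm E X k} (hα : α.IsSmooth)
    {e : OpenPartialHomeomorph X E} (he : e ∈ atlas E X) {y : E} (hy : y ∈ e.target) :
    α.d.inChart e y = extDeriv (α.inChart e) y := by
  set c := chartAt E (e.symm y) with hc
  have hcm : c ∈ atlas E X := chart_mem_atlas E _
  have hys : e.symm y ∈ c.source := mem_chart_source E _
  have h1 : α.inChart e =ᶠ[𝓝 y] fun z =>
      (α.inChart c ((c ∘ e.symm) z)).compContinuousLinearMap (fderiv ℝ (c ∘ e.symm) z) := by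
    filter_upwards [eventually_mem_transition_source hy hys] with z hz
    exact inChart_apply_transition he hcm hz.1 hz.2 α
  rw [h1.extDeriv_eq, extDeriv_pullback (r := ω) (f := c ∘ e.symm)
    ((hα.inChart_contDiffAt hcm (c.map_source hys)).differentiableAt (by simp))
    (contDiffAt_real_transition he hcm hy hys) (by simp [minSmoothness_of_isRCLikeNormedField]),
    ← restrictScalars_fderiv_transition he hcm hy hys,
    ← chartDeriv_comp_chartSymmDeriv he hcm hy hys]
  rfl

theorem contDiffAt_extDeriv {n : ℕ} {θ : E → E [⋀^Fin n]→L[ℝ] ℝ} {y : E}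
    (hθ : ContDiffAt ℝ ∞ θ y) : ContDiffAt ℝ ∞ (extDeriv θ) y :=
  ContDiffAt.comp (g := ContinuousAlternatingMap.alternatizeUncurryFinCLM ℝ E ℝ) (f := fderiv ℝ θ) y
    (ContinuousLinearMap.contDiff _).contDiffAt (hθ.fderiv_right (m := ∞) (by simp))

theorem IsSmooth.d {α : RealForm E X k} (hα : α.IsSmooth) : α.d.IsSmooth := by
  intro e he y hy
  refine (contDiffAt_extDeriv (hα.inChart_contDiffAt he hy)).congr_of_eventuallyEq ?_
    |>.contDiffWithinAt
  filter_upwards [e.open_target.eventually_mem hy] with z hz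
  exact hα.inChart_d he hz

theorem IsSmooth.d_d {α : RealForm E X k} (hα : α.IsSmooth) : α.d.d = 0 := by
  funext x
  have hx := mem_chart_target E x
  have h1 : α.d.inChart (chartAt E x) =ᶠ[𝓝 (chartAt E x x)]
      extDeriv (α.inChart (chartAt E x)) := by
    filter_upwards [(chartAt E x).open_target.eventually_mem hx] with z hz
    exact hα.inChart_d (chart_mem_atlas E x) hz
  have h2 : extDeriv (extDeriv (α.inChart (chartAt E x))) (chartAt E x x) = 0 :=
    extDeriv_extDeriv_apply (hα.inChart_contDiffAt (chart_mem_atlas E x) hx)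
      (by rw [minSmoothness_of_isRCLikeNormedField]; exact ENat.LEInfty.out)
  rw [RealForm.d, h1.extDeriv_eq, h2]
  rfl

theorem IsSmooth.d_mem_closedForms {α : RealForm E X k} (hα : α.IsSmooth) :
    α.d ∈ closedForms E X (k + 1) :=
  ⟨hα.d, hα.d_d⟩

theorem IsSmooth.represents_d_zero {α : RealForm E X k} (hα : α.IsSmooth) :
    α.d.Represents 0 :=
  ⟨hα.d_mem_closedForms, (Submodule.Quotient.mk_eq_zero _).2 ⟨α, hα, rfl⟩⟩

end RealForm

end ComplexCharts

/-! ## Jacobians and Hermitian metrics given by densities -/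

section Density

variable {E : Type*} [NormedAddCommGroup E] [NormedSpace ℂ E]
variable {X : Type*} [TopologicalSpace X] [ChartedSpace E X]
variable {Y : Type*} [TopologicalSpace Y] [ChartedSpace E Y]
variable {Z : Type*} [TopologicalSpace Z] [ChartedSpace E Z]

variable (E) in
/-- The complex Jacobian determinant of a map between manifolds modelled on `E`, in the preferred
trivializations of the tangent bundles. -/
noncomputable def jacobian (F : X → Y) (x : X) : ℂ :=
  LinearMap.det (mfderiv 𝓘(ℂ, E) 𝓘(ℂ, E) F x : E →L[ℂ] E).toLinearMap

theorem jacobian_comp {G : Y → Z} {F : X → Y} {x : X}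
    (hG : MDifferentiableAt 𝓘(ℂ, E) 𝓘(ℂ, E) G (F x))
    (hF : MDifferentiableAt 𝓘(ℂ, E) 𝓘(ℂ, E) F x) :
    jacobian E (G ∘ F) x = jacobian E G (F x) * jacobian E F x := by
  unfold jacobian
  rw [mfderiv_comp (I' := 𝓘(ℂ, E)) x hG hF]
  exact LinearMap.det_comp _ _

theorem jacobian_id (x : X) : jacobian E (id : X → X) x = 1 := by
  unfold jacobian
  rw [mfderiv_id]
  exact LinearMap.det_id

theorem jacobian_congr {F G : X → Y} {x : X} (h : F =ᶠ[𝓝 x] G) :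
    jacobian E F x = jacobian E G x := by
  unfold jacobian
  have := h.mfderiv_eq (I := 𝓘(ℂ, E)) (I' := 𝓘(ℂ, E))
  exact congrArg (fun A : E →L[ℂ] E => LinearMap.det A.toLinearMap) this

theorem jacobian_model (F : E → E) (y : E) :
    jacobian E F y = LinearMap.det (fderiv ℂ F y).toLinearMap := by
  unfold jacobian
  rw [mfderiv_eq_fderiv]
  rfl

theorem jacobian_chart_mul_symm [IsManifold 𝓘(ℂ, E) ω X] {e : OpenPartialHomeomorph X E}
    (he : e ∈ atlas E X) {y : E} (hy : y ∈ e.target) :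
    jacobian E e (e.symm y) * jacobian E e.symm y = 1 := by
  rw [← jacobian_comp (mdifferentiableAt_of_mem_atlas he (e.map_target hy))
    (mdifferentiableAt_symm_of_mem_atlas he hy), ← jacobian_id (E := E) y]
  refine jacobian_congr ?_
  filter_upwards [e.open_target.eventually_mem hy] with z hz
  exact e.right_inv hz

theorem jacobian_chart_ne_zero [IsManifold 𝓘(ℂ, E) ω X] {e : OpenPartialHomeomorph X E}
    (he : e ∈ atlas E X) {x : X} (hx : x ∈ e.source) : jacobian E e x ≠ 0 := by
  have h := jacobian_chart_mul_symm he (e.map_source hx)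
  rw [e.left_inv hx] at h
  exact left_ne_zero_of_mul_eq_one h

variable [FiniteDimensional ℂ E]

/-- Top-degree forms make up a line with evaluation on the basis as coordinate, and pullback by `A`
acts on this line as the scalar `det A`. All computations with canonical forms thereby reduce to
Jacobian determinants. -/
theorem compLinearMap_apply_finBasis (α : CanonicalFiber E) (A : E →ₗ[ℂ] E) :
    α.compLinearMap A (Module.finBasis ℂ E) = LinearMap.det A * α (Module.finBasis ℂ E) := by
  rw [AlternatingMap.compLinearMap_apply]
  conv_lhs => rw [AlternatingMap.eq_smul_basis_det (Module.finBasis ℂ E) α]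
  have h := Module.Basis.det_comp (Module.finBasis ℂ E) A (Module.finBasis ℂ E)
  rw [Module.Basis.det_self, mul_one] at h
  rw [AlternatingMap.smul_apply, smul_eq_mul, mul_comm]
  exact congrArg (· * _) h

theorem canonicalPullback_apply_finBasis (F : X → Y) (x : X) (α : CanonicalFiber E) :
    canonicalPullback F x α (Module.finBasis ℂ E) =
      jacobian E F x * α (Module.finBasis ℂ E) :=
  compLinearMap_apply_finBasis α _

theorem canonicalFrame_apply_finBasis (e : OpenPartialHomeomorph X E) (x : X) :
    canonicalFrame e x (Module.finBasis ℂ E) = jacobian E e x := by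
  refine (compLinearMap_apply_finBasis _ _).trans ?_
  rw [standardVolume, Module.Basis.det_self, mul_one]
  rfl

theorem canonicalCoeff_eq (e : OpenPartialHomeomorph X E) (σ : X → CanonicalFiber E) (y : E) :
    canonicalCoeff e σ y =
      jacobian E e.symm y * σ (e.symm y) (Module.finBasis ℂ E) :=
  compLinearMap_apply_finBasis _ _

theorem CanonicalFiber.eq_smul_standardVolume (α : CanonicalFiber E) :
    α = α (Module.finBasis ℂ E) • standardVolume E :=
  AlternatingMap.eq_smul_basis_det _ α

namespace CanonicalMetric

/-- The squared norm of the standard volume form of the model space. -/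
noncomputable def weight (h : CanonicalMetric E X) (x : X) : ℝ :=
  (h.inner x (standardVolume E) (standardVolume E)).re

theorem weight_pos (h : CanonicalMetric E X) (x : X) : 0 < h.weight x :=
  h.pos x _ (Module.Basis.det_ne_zero _)

theorem inner_self_re (h : CanonicalMetric E X) (x : X) (α : CanonicalFiber E) :
    (h.inner x α α).re = Complex.normSq (α (Module.finBasis ℂ E)) * h.weight x := by
  conv_lhs => rw [CanonicalFiber.eq_smul_standardVolume α]
  rw [map_smulₛₗ, map_smul, LinearMap.smul_apply, smul_eq_mul, smul_eq_mul, ← mul_assoc,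
    mul_comm (starRingEnd ℂ _), Complex.mul_conj, Complex.re_ofReal_mul]
  rfl

theorem frame_normSq (h : CanonicalMetric E X) (e : OpenPartialHomeomorph X E) (x : X) :
    (h.inner x (canonicalFrame e x) (canonicalFrame e x)).re =
      Complex.normSq (jacobian E e x) * h.weight x := by
  rw [inner_self_re, canonicalFrame_apply_finBasis]

end CanonicalMetric

/-- The Hermitian product on a fibre of the canonical bundle in which the standard volume form has
squared norm `w`. -/
noncomputable def weightedInner (w : ℝ) : CanonicalFiber E →ₗ[ℂ] CanonicalFiber E →ₗ⋆[ℂ] ℂ :=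
  LinearMap.mk₂'ₛₗ (RingHom.id ℂ) (starRingEnd ℂ)
    (fun α β => α (Module.finBasis ℂ E) * starRingEnd ℂ (β (Module.finBasis ℂ E)) * w)
    (fun α α' β => by rw [AlternatingMap.add_apply]; ring)
    (fun c α β => by rw [AlternatingMap.smul_apply, smul_eq_mul, RingHom.id_apply, smul_eq_mul]; ring)
    (fun α β β' => by rw [AlternatingMap.add_apply, map_add]; ring)
    (fun c α β => by rw [AlternatingMap.smul_apply, smul_eq_mul, map_mul, smul_eq_mul]; ring)

theorem weightedInner_apply (w : ℝ) (α β : CanonicalFiber E) :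
    weightedInner w α β =
      α (Module.finBasis ℂ E) * starRingEnd ℂ (β (Module.finBasis ℂ E)) * w :=
  rfl

/-- The function `w` defines a metric which in every chart is the square of the absolute value of
a nowhere vanishing holomorphic function. -/
def HasHolomorphicDensity (w : X → ℝ) : Prop :=
  ∀ e ∈ atlas E X, ∀ y ∈ e.target, ∃ g : E → ℂ, ContDiffAt ℂ ω g y ∧ g y ≠ 0 ∧
    ∀ᶠ z in 𝓝 y, Complex.normSq (jacobian E e (e.symm z)) * w (e.symm z) = Complex.normSq (g z)

theorem HasHolomorphicDensity.pos {w : X → ℝ} (hw : HasHolomorphicDensity (E := E) w) (x : X) :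
    0 < w x := by
  obtain ⟨g, -, hg, h⟩ := hw (chartAt E x) (chart_mem_atlas E x) _ (mem_chart_target E x)
  have h := h.self_of_nhds
  rw [(chartAt E x).left_inv (mem_chart_source E x)] at h
  exact pos_of_mul_pos_right (h ▸ Complex.normSq_pos.2 hg) (Complex.normSq_nonneg _)

theorem contDiffAt_normSq_comp {g : E → ℂ} {y : E} (hg : ContDiffAt ℂ ω g y) :
    ContDiffAt ℝ ∞ (fun z => Complex.normSq (g z)) y := by
  have h : ContDiffAt ℝ ∞ g y := (hg.restrict_scalars ℝ).of_le le_top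
  have h1 : ContDiffAt ℝ ∞ (fun z => (g z).re) y :=
    Complex.reCLM.contDiff.contDiffAt.comp y h
  have h2 : ContDiffAt ℝ ∞ (fun z => (g z).im) y :=
    Complex.imCLM.contDiff.contDiffAt.comp y h
  simp only [Complex.normSq_apply]
  exact (h1.mul h1).add (h2.mul h2)

/-- The metric in which the standard volume form of the model space has squared norm `w`. -/
noncomputable def CanonicalMetric.ofDensity (w : X → ℝ) (hw : HasHolomorphicDensity (E := E) w) :
    CanonicalMetric E X where
  inner x := weightedInner (w x)
  conj_symm x α β := by
    rw [weightedInner_apply, weightedInner_apply, map_mul, map_mul, Complex.conj_conj,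
      Complex.conj_ofReal]
    ring
  pos x α hα := by
    rw [weightedInner_apply, Complex.mul_conj, ← Complex.ofReal_mul, Complex.ofReal_re]
    exact mul_pos (Complex.normSq_pos.2 fun h => hα
      ((AlternatingMap.map_basis_eq_zero_iff (Module.finBasis ℂ E) α).1 h)) (hw.pos x)
  smooth e he y hy := by
    obtain ⟨g, hg, -, h⟩ := hw e he y hy
    refine ((contDiffAt_normSq_comp hg).congr_of_eventuallyEq ?_).contDiffWithinAt
    filter_upwards [h] with z hz
    rw [weightedInner_apply, Complex.mul_conj, ← Complex.ofReal_mul, Complex.ofReal_re,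
      canonicalFrame_apply_finBasis, hz]

theorem CanonicalMetric.ofDensity_inner {w : X → ℝ} (hw : HasHolomorphicDensity (E := E) w)
    (x : X) (α β : CanonicalFiber E) : (CanonicalMetric.ofDensity w hw).inner x α β =
      α (Module.finBasis ℂ E) * starRingEnd ℂ (β (Module.finBasis ℂ E)) * w x :=
  rfl

theorem CanonicalMetric.ofDensity_weight {w : X → ℝ} (hw : HasHolomorphicDensity (E := E) w)
    (x : X) : (CanonicalMetric.ofDensity w hw).weight x = w x := by
  rw [CanonicalMetric.weight, CanonicalMetric.ofDensity_inner, Complex.mul_conj,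
    ← Complex.ofReal_mul, Complex.ofReal_re, standardVolume, Module.Basis.det_self, map_one,
    one_mul]

theorem CanonicalMetric.ofDensity_isPullback {w : X → ℝ} (hw : HasHolomorphicDensity (E := E) w)
    {w' : Y → ℝ} (hw' : HasHolomorphicDensity (E := E) w') {F : X → Y}
    (hF : ∀ x, Complex.normSq (jacobian E F x) * w x = w' (F x)) :
    (CanonicalMetric.ofDensity w hw).IsPullback F (CanonicalMetric.ofDensity w' hw') := by
  intro x α β
  rw [ofDensity_inner, ofDensity_inner, canonicalPullback_apply_finBasis,
    canonicalPullback_apply_finBasis, ← hF, Complex.ofReal_mul, Complex.normSq_eq_conj_mul_self,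
    map_mul]
  ring

/-! ### Pluriharmonic functions and flatness -/

theorem iddbar_congr {u v : E → ℝ} {y : E} (h : u =ᶠ[𝓝 y] v) : iddbar u y = iddbar v y := by
  rw [iddbar, iddbar]
  congr 1
  refine Filter.EventuallyEq.extDeriv_eq ?_
  filter_upwards [h.eventuallyEq_nhds] with z hz
  rw [hz.fderiv_eq]

/-- By the Cauchy–Riemann equations `d(Re F) ∘ J = d(-Im F)`, which is exact, and `d ∘ d = 0`. -/
theorem iddbar_re_eq_zero {F : E → ℂ} {y : E} (hF : ContDiffAt ℂ ω F y) :
    iddbar (fun z => (F z).re) y = 0 := by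
  have h1 : ∀ᶠ z in 𝓝 y, ContDiffAt ℂ ω F z := hF.eventually (by simp)
  have him : ContDiffAt ℝ ω (fun z => -(F z).im) y :=
    (Complex.imCLM.contDiff.contDiffAt.comp y (hF.restrict_scalars ℝ)).neg
  have h2 : (fun z => ContinuousAlternatingMap.ofSubsingleton ℝ E ℝ (0 : Fin 1)
      ((fderiv ℝ (fun z => (F z).re) z).comp
        ((Complex.I • ContinuousLinearMap.id ℂ E).restrictScalars ℝ))) =ᶠ[𝓝 y]
      extDeriv fun z => ContinuousAlternatingMap.constOfIsEmpty ℝ E (Fin 0) (-(F z).im) := by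
    filter_upwards [h1] with z hz
    have hd : HasFDerivAt F ((fderiv ℂ F z).restrictScalars ℝ) z :=
      (hz.differentiableAt (by simp)).hasFDerivAt.restrictScalars ℝ
    have hre : HasFDerivAt (fun z => (F z).re)
      (Complex.reCLM.comp ((fderiv ℂ F z).restrictScalars ℝ)) z :=
      Complex.reCLM.hasFDerivAt.comp z hd
    have him : HasFDerivAt (fun z => -(F z).im)
      (-(Complex.imCLM.comp ((fderiv ℂ F z).restrictScalars ℝ))) z :=
      (Complex.imCLM.hasFDerivAt.comp z hd).neg
    rw [extDeriv_constOfIsEmpty, hre.fderiv, him.fderiv]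
    congr 1
    ext v
    simp
  have h3 : extDeriv (extDeriv fun z =>
      ContinuousAlternatingMap.constOfIsEmpty ℝ E (Fin 0) (-(F z).im)) y = 0 := by
    refine extDeriv_extDeriv_apply (r := ω) ?_ (by simp [minSmoothness_of_isRCLikeNormedField])
    exact (ContinuousAlternatingMap.constOfIsEmptyLIE ℝ E ℝ (Fin 0)).contDiff.contDiffAt.comp y him
  rw [iddbar, h2.extDeriv_eq, h3, smul_zero]

theorem iddbar_log_normSq_eq_zero {g : E → ℂ} {y : E} (hg : ContDiffAt ℂ ω g y) (hy : g y ≠ 0) :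
    iddbar (fun z => Real.log (Complex.normSq (g z))) y = 0 := by
  have hdiv : ContDiffAt ℂ ω (fun z => g z / g y) y := hg.div_const _
  have hone : g y / g y ∈ Complex.slitPlane := by
    rw [div_self hy]
    exact Complex.one_mem_slitPlane
  -- Locally `log |g|²` is the real part of this holomorphic function. Dividing by `g y` moves the
  -- value at `y` to `1`, away from the cut of the principal logarithm.
  have hF : ContDiffAt ℂ ω (fun z => 2 * Complex.log (g z / g y) + Real.log (Complex.normSq (g y)))
      y := (contDiffAt_const.mul ((Complex.contDiffAt_log hone).comp y hdiv)).add contDiffAt_const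
  rw [← iddbar_re_eq_zero hF]
  refine iddbar_congr ?_
  filter_upwards [hg.continuousAt.eventually_ne hy] with z hz
  rw [Complex.add_re, Complex.ofReal_re, ← Complex.ofReal_ofNat, Complex.re_ofReal_mul,
    Complex.log_re, norm_div, Real.log_div (norm_ne_zero_iff.2 hz) (norm_ne_zero_iff.2 hy),
    Complex.normSq_eq_norm_sq, Complex.normSq_eq_norm_sq, Real.log_pow, Real.log_pow]
  push_cast
  ring

theorem CanonicalMetric.ofDensity_isFlat {w : X → ℝ} (hw : HasHolomorphicDensity (E := E) w) :
    (CanonicalMetric.ofDensity w hw).IsFlat := by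
  funext x
  obtain ⟨g, hg, hg0, h⟩ := hw (chartAt E x) (chart_mem_atlas E x) _ (mem_chart_target E x)
  have h1 : (CanonicalMetric.ofDensity w hw).logNorm (chartAt E x) =ᶠ[𝓝 (chartAt E x x)]
      fun z => Real.log (Complex.normSq (g z)) := by
    filter_upwards [h] with z hz
    rw [CanonicalMetric.logNorm, CanonicalMetric.frame_normSq, ofDensity_weight, hz]
  rw [CanonicalMetric.curvature, iddbar_congr h1, iddbar_log_normSq_eq_zero hg hg0]
  exact neg_zero

end Density

/-! ## Chern classes of a canonical bundle with a flat metric -/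

section FlatMetric

variable {E : Type*} [NormedAddCommGroup E] [NormedSpace ℂ E]
variable {X : Type*} [TopologicalSpace X] [ChartedSpace E X]

/-- The one-form `du ∘ J` on `E`. -/
noncomputable def dcModel (u : E → ℝ) (z : E) : E [⋀^Fin 1]→L[ℝ] ℝ :=
  ContinuousAlternatingMap.ofSubsingleton ℝ E ℝ (0 : Fin 1)
    ((fderiv ℝ u z).comp ((Complex.I • ContinuousLinearMap.id ℂ E).restrictScalars ℝ))

theorem iddbar_eq (u : E → ℝ) (y : E) :
    iddbar u y = (-(1 / 2) : ℝ) • extDeriv (dcModel u) y :=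
  rfl

theorem contDiffAt_dcModel {u : E → ℝ} {y : E} (hu : ContDiffAt ℝ ∞ u y) :
    ContDiffAt ℝ ∞ (dcModel u) y := by
  have h1 : ContDiffAt ℝ ∞ (fderiv ℝ u) y := hu.fderiv_right (by simp)
  have h2 : ContDiffAt ℝ ∞ (fun z => (fderiv ℝ u z).comp
      ((Complex.I • ContinuousLinearMap.id ℂ E).restrictScalars ℝ)) y :=
    h1.clm_comp contDiffAt_const
  exact (ContinuousAlternatingMap.ofSubsingletonLIE (𝕜 := ℝ) (E := E) (F := ℝ) (0 : Fin 1)).contDiff.contDiffAt.comp y h2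

theorem iddbar_sub {u v : E → ℝ} {y : E} (hu : ContDiffAt ℝ ∞ u y) (hv : ContDiffAt ℝ ∞ v y) :
    iddbar u y = iddbar (u - v) y + iddbar v y := by
  have hd : ∀ {w : E → ℝ}, ContDiffAt ℝ ∞ w y → DifferentiableAt ℝ (dcModel w) y := fun hw =>
    (contDiffAt_dcModel hw).differentiableAt (by simp)
  rw [iddbar_eq, iddbar_eq, iddbar_eq, ← smul_add,
    ← extDeriv_add (hd (w := u - v) (hu.sub hv)) (hd hv)]
  congr 1
  refine Filter.EventuallyEq.extDeriv_eq ?_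
  filter_upwards [(hu.of_le (m := 1) (by simp)).eventually (by simp),
    (hv.of_le (m := 1) (by simp)).eventually (by simp)] with z hzu hzv
  rw [Pi.add_apply, dcModel, dcModel, dcModel, fderiv_sub (hzu.differentiableAt (by simp))
    (hzv.differentiableAt (by simp)), ContinuousLinearMap.sub_comp]
  ext v
  simp

/-- The one-form `dφ ∘ J` on a complex manifold. -/
noncomputable def RealForm.dc (φ : X → ℝ) : RealForm E X 1 :=
  fun x => (dcModel (φ ∘ (chartAt E x).symm) (chartAt E x x)).compContinuousLinearMap
    ((chartDeriv (chartAt E x) x).restrictScalars ℝ)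

variable (E) in
/-- A function which is smooth in all charts. -/
def IsChartSmooth (φ : X → ℝ) : Prop :=
  ∀ e ∈ atlas E X, ∀ y ∈ e.target, ContDiffAt ℝ ∞ (φ ∘ e.symm) y

variable [IsManifold 𝓘(ℂ, E) ω X]

/-- The derivatives of transition maps are complex linear, so they commute with `J`, and `dφ ∘ J`
does not depend on the chart. -/
theorem RealForm.inChart_dc {φ : X → ℝ} (hφ : IsChartSmooth E φ) {e : OpenPartialHomeomorph X E}
    (he : e ∈ atlas E X) {y : E} (hy : y ∈ e.target) :
    (RealForm.dc φ : RealForm E X 1).inChart e y = dcModel (φ ∘ e.symm) y := by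
  set c := chartAt E (e.symm y) with hc
  have hcm : c ∈ atlas E X := chart_mem_atlas E _
  have hys : e.symm y ∈ c.source := mem_chart_source E _
  have h1 : φ ∘ e.symm =ᶠ[𝓝 y] (φ ∘ c.symm) ∘ (c ∘ e.symm) := by
    filter_upwards [eventually_mem_transition_source hy hys] with z hz
    simp only [Function.comp_apply, c.left_inv hz.2]
  have h2 : fderiv ℝ (φ ∘ e.symm) y = (fderiv ℝ (φ ∘ c.symm) (c (e.symm y))).comp
      (((chartDeriv c (e.symm y)).comp (chartSymmDeriv e y)).restrictScalars ℝ) := by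
    rw [h1.fderiv_eq, fderiv_comp y ((hφ c hcm _ (c.map_source hys)).differentiableAt (by simp))
      ((contDiffAt_real_transition he hcm hy hys).differentiableAt (by simp)),
      chartDeriv_comp_chartSymmDeriv he hcm hy hys,
      restrictScalars_fderiv_transition he hcm hy hys]
    rfl
  rw [RealForm.inChart, RealForm.dc, dcModel, dcModel, h2]
  ext v
  simp [hc]

theorem RealForm.dc_isSmooth {φ : X → ℝ} (hφ : IsChartSmooth E φ) :
    (RealForm.dc φ : RealForm E X 1).IsSmooth := by
  intro e he y hy
  refine ((contDiffAt_dcModel (hφ e he y hy)).congr_of_eventuallyEq ?_).contDiffWithinAt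
  filter_upwards [e.open_target.eventually_mem hy] with z hz
  exact RealForm.inChart_dc hφ he hz

theorem RealForm.d_dc {φ : X → ℝ} (hφ : IsChartSmooth E φ) (x : X) :
    (RealForm.dc φ : RealForm E X 1).d x =
      ((-2 : ℝ) • iddbar (φ ∘ (chartAt E x).symm) (chartAt E x x)).compContinuousLinearMap
        ((chartDeriv (chartAt E x) x).restrictScalars ℝ) := by
  have hx := mem_chart_target E x
  have h : (RealForm.dc φ : RealForm E X 1).inChart (chartAt E x) =ᶠ[𝓝 (chartAt E x x)]
      dcModel (φ ∘ (chartAt E x).symm) := by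
    filter_upwards [(chartAt E x).open_target.eventually_mem hx] with z hz
    exact RealForm.inChart_dc hφ (chart_mem_atlas E x) hz
  rw [RealForm.d, h.extDeriv_eq, iddbar_eq, smul_smul]
  norm_num

variable [FiniteDimensional ℂ E]

namespace CanonicalMetric

theorem logNorm_eq (h : CanonicalMetric E X) {e : OpenPartialHomeomorph X E} (he : e ∈ atlas E X)
    {y : E} (hy : y ∈ e.target) :
    h.logNorm e y =
      Real.log (Complex.normSq (jacobian E e (e.symm y))) + Real.log (h.weight (e.symm y)) := by
  rw [logNorm, frame_normSq, Real.log_mul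
    (Complex.normSq_pos.2 (jacobian_chart_ne_zero he (e.map_target hy))).ne' (h.weight_pos _).ne']

theorem contDiffAt_logNorm (h : CanonicalMetric E X) {e : OpenPartialHomeomorph X E}
    (he : e ∈ atlas E X) {y : E} (hy : y ∈ e.target) : ContDiffAt ℝ ∞ (h.logNorm e) y := by
  refine ((h.smooth e he).contDiffAt (e.open_target.mem_nhds hy)).log ?_
  rw [frame_normSq]
  exact (mul_pos (Complex.normSq_pos.2 (jacobian_chart_ne_zero he (e.map_target hy)))
    (h.weight_pos _)).ne'

/-- The logarithm of the quotient of two Hermitian metrics. -/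
noncomputable def logRatio (h h₀ : CanonicalMetric E X) (x : X) : ℝ :=
  Real.log (h.weight x) - Real.log (h₀.weight x)

/-- The term `log |jacobian|²` of the frame is the same for both metrics and cancels. The ratio is
thus a smooth global function although neither weight need be smooth. -/
theorem logRatio_comp_symm (h h₀ : CanonicalMetric E X) {e : OpenPartialHomeomorph X E}
    (he : e ∈ atlas E X) {y : E} (hy : y ∈ e.target) :
    h.logRatio h₀ ∘ e.symm =ᶠ[𝓝 y] h.logNorm e - h₀.logNorm e := by
  filter_upwards [e.open_target.eventually_mem hy] with z hz
  rw [Pi.sub_apply, logNorm_eq h he hz, logNorm_eq h₀ he hz, add_sub_add_left_eq_sub]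
  rfl

theorem isChartSmooth_logRatio (h h₀ : CanonicalMetric E X) : IsChartSmooth E (h.logRatio h₀) :=
  fun _ he _ hy => ((h.contDiffAt_logNorm he hy).sub (h₀.contDiffAt_logNorm he hy)).congr_of_eventuallyEq
    (logRatio_comp_symm h h₀ he hy)

/-- Here `1 / 2` turns `d (dc φ) = -2 i∂∂̄ φ` into `-i∂∂̄ φ`, where `φ` is the logarithm of the
ratio of the metrics. -/
theorem curvature_eq_add (h h₀ : CanonicalMetric E X) :
    h.curvature = (1 / 2 : ℝ) • (RealForm.dc (h.logRatio h₀) : RealForm E X 1).d + h₀.curvature := by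
  funext x
  have hx := mem_chart_target E x
  have he := chart_mem_atlas E x
  change _ = (1 / 2 : ℝ) • (RealForm.dc (h.logRatio h₀) : RealForm E X 1).d x + h₀.curvature x
  rw [RealForm.d_dc (isChartSmooth_logRatio h h₀),
    iddbar_congr (logRatio_comp_symm h h₀ he hx), curvature, curvature,
    iddbar_sub (h.contDiffAt_logNorm he hx) (h₀.contDiffAt_logNorm he hx)]
  ext v
  simp only [ContinuousAlternatingMap.neg_apply, ContinuousAlternatingMap.add_apply,
    ContinuousAlternatingMap.smul_apply, ContinuousAlternatingMap.compContinuousLinearMap_apply,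
    smul_eq_mul]
  ring

theorem IsFlat.chernForm_eq_zero {h : CanonicalMetric E X} (hh : h.IsFlat) : h.chernForm = 0 := by
  rw [chernForm, hh, smul_zero]

theorem IsFlat.isCanonicalChernClass_zero {h₀ : CanonicalMetric E X} (h₀_flat : h₀.IsFlat) :
    IsCanonicalChernClass (0 : DeRhamCohomology E X 2) := by
  refine ⟨⟨h₀⟩, fun h => ?_⟩
  have hs : ((1 / (2 * Real.pi)) • (1 / 2 : ℝ) •
      (RealForm.dc (h.logRatio h₀) : RealForm E X 1)).IsSmooth :=
    ((RealForm.dc_isSmooth (isChartSmooth_logRatio h h₀)).smul _).smul _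
  have := hs.represents_d_zero
  rw [RealForm.d_smul, RealForm.d_smul] at this
  rwa [chernForm, curvature_eq_add h h₀, show h₀.curvature = 0 from h₀_flat, add_zero]

theorem IsFlat.isCanonicalNef {h₀ : CanonicalMetric E X} (h₀_flat : h₀.IsFlat) :
    IsCanonicalNef E X := by
  intro η _ hη ε hε
  refine ⟨h₀, fun x v => ?_⟩
  have h0 : h₀.curvature x ![v, Complex.I • v] = 0 := by
    rw [show h₀.curvature = 0 from h₀_flat]
    rfl
  have hnonneg : 0 ≤ η x ![v, Complex.I • v] := by
    rcases eq_or_ne v 0 with rfl | hv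
    · exact (ContinuousAlternatingMap.map_coord_zero _ (i := 0) rfl).ge
    · exact (hη.pos x v hv).le
  rw [h0]
  exact mul_nonpos_of_nonpos_of_nonneg (neg_nonpos.2 hε.le) hnonneg

end CanonicalMetric

/-! ### Powers of the Chern class -/

theorem pairProd_zero_right {W : Type*} [AddCommGroup W] [Module ℝ W] [TopologicalSpace W]
    (η : W [⋀^Fin 2]→L[ℝ] ℝ) (v : Fin (0 * 2) → W) : pairProd η 0 v = 1 :=
  Finset.prod_eq_one (s := Finset.univ) (f := fun i : Fin 0 => η fun j => v (finProdFinEquiv (i, j)))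
    fun i _ => i.elim0

theorem wedgePow_zero_right {W : Type*} [AddCommGroup W] [Module ℝ W] [TopologicalSpace W]
    (η : W [⋀^Fin 2]→L[ℝ] ℝ) (v : Fin (0 * 2) → W) : wedgePow η 0 v = 1 := by
  rw [wedgePow, ContinuousAlternatingMap.smul_apply,
    ContinuousMultilinearMap.alternatization_apply_apply]
  have : IsEmpty (Fin (0 * 2)) := inferInstanceAs (IsEmpty (Fin 0))
  simpa using pairProd_zero_right η v

theorem wedgePow_zero_left {W : Type*} [AddCommGroup W] [Module ℝ W] [TopologicalSpace W]
    {k : ℕ} (hk : k ≠ 0) : wedgePow (0 : W [⋀^Fin 2]→L[ℝ] ℝ) k = 0 := by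
  have h : pairProd (0 : W [⋀^Fin 2]→L[ℝ] ℝ) k = 0 := by
    ext v
    obtain ⟨i⟩ : Nonempty (Fin k) := ⟨⟨0, Nat.pos_of_ne_zero hk⟩⟩
    exact Finset.prod_eq_zero (Finset.mem_univ i) rfl
  rw [wedgePow, h, map_zero, smul_zero]

theorem RealForm.mem_closedForms_of_forall_eq_one {α : RealForm E X (0 * 2)}
    (hα : ∀ x v, α x v = 1) : α ∈ closedForms E X (0 * 2) := by
  have hconst : ∀ e : OpenPartialHomeomorph X E,
      α.inChart e = fun _ => wedgePow (0 : E [⋀^Fin 2]→L[ℝ] ℝ) 0 := by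
    intro e
    funext y
    ext v
    rw [wedgePow_zero_right, RealForm.inChart,
      ContinuousAlternatingMap.compContinuousLinearMap_apply, hα]
  refine ⟨fun e _ => ?_, ?_⟩
  · rw [hconst]
    exact contDiffOn_const
  · funext x
    rw [RealForm.d, hconst, extDeriv, fderiv_fun_const, Pi.zero_apply,
      ← ContinuousAlternatingMap.alternatizeUncurryFinCLM_apply, map_zero]
    rfl

theorem wedgePow_zero_mem_closedForms (η : RealForm E X 2) :
    (fun x => wedgePow (η x) 0 : RealForm E X (0 * 2)) ∈ closedForms E X (0 * 2) :=
  RealForm.mem_closedForms_of_forall_eq_one fun _ _ => wedgePow_zero_right _ _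

/-- In degree `0` only the zero form is exact, so the constant `1` has nonzero class as soon as `X`
has a point. For `k > 0` a class that serves all metrics can be computed with the flat one, where it
vanishes. -/
theorem CanonicalMetric.IsFlat.hasCanonicalNumericalDimension_zero [Nonempty X]
    {h₀ : CanonicalMetric E X} (h₀_flat : h₀.IsFlat) : HasCanonicalNumericalDimension E X 0 := by
  refine ⟨h₀_flat.isCanonicalNef, ?_, ?_⟩
  · refine ⟨Submodule.Quotient.mk ⟨_, wedgePow_zero_mem_closedForms 0⟩, ⟨⟨h₀⟩, fun h => ?_⟩, ?_⟩
    · refine ⟨wedgePow_zero_mem_closedForms _, ?_⟩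
      congr 2
    · intro h0
      have h1 : (fun x => wedgePow ((0 : RealForm E X 2) x) 0 : RealForm E X (0 * 2)) = 0 :=
        (Submodule.Quotient.mk_eq_zero _).1 h0
      obtain ⟨x⟩ := ‹Nonempty X›
      have h2 := congrArg (fun α : E [⋀^Fin (0 * 2)]→L[ℝ] ℝ => α 0) (congrFun h1 x)
      exact one_ne_zero ((wedgePow_zero_right _ _).symm.trans h2)
  · rintro k ⟨c, ⟨-, hc⟩, hc0⟩
    by_contra hk
    refine hc0 ?_
    obtain ⟨hmem, rfl⟩ := hc h₀
    refine (Submodule.Quotient.mk_eq_zero _).2 ?_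
    have h0 : (fun x => wedgePow (h₀.chernForm x) k : RealForm E X (k * 2)) = 0 := by
      funext x
      rw [h₀_flat.chernForm_eq_zero]
      exact wedgePow_zero_left fun h => hk h.le
    rw [Submodule.mem_comap, Submodule.subtype_apply]
    change (fun x => wedgePow (h₀.chernForm x) k : RealForm E X (k * 2)) ∈ _
    rw [h0]
    exact zero_mem _

end FlatMetric

/-! ## Automorphisms of compact manifolds with trivial canonical bundle preserve volume -/

section VolumePreserving

open MeasureTheory

variable {E : Type*} [NormedAddCommGroup E] [NormedSpace ℂ E] [FiniteDimensional ℂ E]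

theorem contDiff_det : ContDiff ℂ ω fun A : E →L[ℂ] E => LinearMap.det A.toLinearMap := by
  have h : (fun A : E →L[ℂ] E => LinearMap.det A.toLinearMap) = fun A : E →L[ℂ] E =>
      ∑ τ : Equiv.Perm (Fin (Module.finrank ℂ E)), ((Equiv.Perm.sign τ : ℤ) : ℂ) *
        ∏ i, (Module.finBasis ℂ E).coord (τ i) (A (Module.finBasis ℂ E i)) := by
    funext A
    rw [← LinearMap.det_toMatrix (Module.finBasis ℂ E), Matrix.det_apply']
    simp only [LinearMap.toMatrix_apply]
    rfl
  rw [h]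
  refine ContDiff.sum fun τ _ => contDiff_const.mul (contDiff_prod fun i _ => ?_)
  exact (LinearMap.toContinuousLinearMap ((Module.finBasis ℂ E).coord (τ i))).contDiff.comp
    (contDiff_id.clm_apply contDiff_const)

/-- The real determinant of a complex linear map is the norm from `ℂ` to `ℝ` of its complex
determinant. This links real volume to holomorphic Jacobians. -/
theorem abs_det_restrictScalars (A : E →L[ℂ] E) :
    |(A.restrictScalars ℝ).det| = Complex.normSq (LinearMap.det A.toLinearMap) := by
  have h : (A.restrictScalars ℝ).det = Complex.normSq (LinearMap.det A.toLinearMap) := by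
    rw [← Algebra.norm_complex_apply]
    exact LinearMap.det_restrictScalars (f := A.toLinearMap)
  rw [h, abs_of_nonneg (Complex.normSq_nonneg _)]

variable {M : Type*} [TopologicalSpace M] [ChartedSpace E M] [IsManifold 𝓘(ℂ, E) ω M]

/-- The coefficient of a canonical form in the preferred trivialization at each point. -/
noncomputable def pointCoeff (σ : M → CanonicalFiber E) (x : M) : ℂ :=
  σ x (Module.finBasis ℂ E)

theorem pointCoeff_ne_zero {σ : M → CanonicalFiber E} {x : M} (h : σ x ≠ 0) :
    pointCoeff σ x ≠ 0 := fun h0 =>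
  h ((AlternatingMap.map_basis_eq_zero_iff (Module.finBasis ℂ E) (σ x)).1 h0)

theorem canonicalCoeff_ne_zero {σ : M → CanonicalFiber E} (hσ0 : ∀ x, σ x ≠ 0)
    {e : OpenPartialHomeomorph M E} (he : e ∈ atlas E M) {y : E} (hy : y ∈ e.target) :
    canonicalCoeff e σ y ≠ 0 := by
  rw [canonicalCoeff_eq]
  exact mul_ne_zero (right_ne_zero_of_mul_eq_one (jacobian_chart_mul_symm he hy))
    (pointCoeff_ne_zero (hσ0 _))

/-- `F^* σ = μ σ` at the point `x`. -/
def ScalesAt (σ : M → CanonicalFiber E) (F : M → M) (μ : ℂ) (x : M) : Prop :=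
  jacobian E F x * pointCoeff σ (F x) = μ * pointCoeff σ x

theorem ScalesAt.comp {σ : M → CanonicalFiber E} {F G : M → M} {μ ν : ℂ} {x : M}
    (hF : MDifferentiableAt 𝓘(ℂ, E) 𝓘(ℂ, E) F x)
    (hG : MDifferentiableAt 𝓘(ℂ, E) 𝓘(ℂ, E) G (F x))
    (hμ : ScalesAt σ F μ x) (hν : ScalesAt σ G ν (F x)) : ScalesAt σ (G ∘ F) (ν * μ) x := by
  rw [ScalesAt] at *
  rw [jacobian_comp hG hF, Function.comp_apply]
  linear_combination jacobian E F x * hν + ν * hμ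

/-- This carries the relation from the preferred trivializations to two fixed charts, in which the
coefficients of a holomorphic `σ` are holomorphic functions. -/
theorem ScalesAt.canonicalCoeff {σ : M → CanonicalFiber E} {F : M → M} {μ : ℂ}
    {e e' : OpenPartialHomeomorph M E} (he : e ∈ atlas E M) (he' : e' ∈ atlas E M) {y : E}
    (hy : y ∈ e.target) (hy' : F (e.symm y) ∈ e'.source)
    (hF : MDifferentiableAt 𝓘(ℂ, E) 𝓘(ℂ, E) F (e.symm y)) (hμ : ScalesAt σ F μ (e.symm y)) :
    canonicalCoeff e' σ (e' (F (e.symm y))) *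
      LinearMap.det (fderiv ℂ (e' ∘ F ∘ e.symm) y).toLinearMap = μ * canonicalCoeff e σ y := by
  have hFe : MDifferentiableAt 𝓘(ℂ, E) 𝓘(ℂ, E) (F ∘ e.symm) y :=
    hF.comp y (mdifferentiableAt_symm_of_mem_atlas he hy)
  have hG : MDifferentiableAt 𝓘(ℂ, E) 𝓘(ℂ, E) (e' ∘ F ∘ e.symm) y :=
    (mdifferentiableAt_of_mem_atlas he' hy').comp y hFe
  have h1 : jacobian E (e'.symm ∘ e' ∘ F ∘ e.symm) y = jacobian E (F ∘ e.symm) y := by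
    refine jacobian_congr ?_
    filter_upwards [hFe.continuousAt.eventually (e'.open_source.eventually_mem hy')] with z hz
    exact e'.left_inv hz
  rw [jacobian_comp (F := e' ∘ F ∘ e.symm) (mdifferentiableAt_symm_of_mem_atlas he' (e'.map_source hy')) hG,
    jacobian_comp hF (mdifferentiableAt_symm_of_mem_atlas he hy)] at h1
  rw [canonicalCoeff_eq, canonicalCoeff_eq, e'.left_inv hy', ← jacobian_model]
  rw [ScalesAt, pointCoeff, pointCoeff] at hμ
  rw [Function.comp_apply, Function.comp_apply] at h1
  linear_combination σ (F (e.symm y)) (Module.finBasis ℂ E) * h1 + jacobian E e.symm y * hμ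

/-- The quotient `F^* σ / σ` does not depend on trivializations. In charts it is a quotient of
holomorphic functions, and the maximum principle makes it constant. -/
theorem exists_scalesAt_of_compactSpace [CompactSpace M] [PreconnectedSpace M]
    {σ : M → CanonicalFiber E}
    (hσ : ∀ e ∈ atlas E M, ContDiffOn ℂ ω (canonicalCoeff e σ) e.target) (hσ0 : ∀ x, σ x ≠ 0)
    {F : M → M} (hF : ContMDiff 𝓘(ℂ, E) 𝓘(ℂ, E) ω F) : ∃ μ : ℂ, ∀ x, ScalesAt σ F μ x := by
  set ratio : M → ℂ := fun x => jacobian E F x * pointCoeff σ (F x) / pointCoeff σ x with hratio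
  have hscale : ∀ x, ScalesAt σ F (ratio x) x := fun x =>
    (div_mul_cancel₀ _ (pointCoeff_ne_zero (hσ0 x))).symm
  have hFd : MDifferentiable 𝓘(ℂ, E) 𝓘(ℂ, E) F := hF.mdifferentiable (by simp)
  have hdiff : MDifferentiable 𝓘(ℂ, E) 𝓘(ℂ, ℂ) ratio := by
    intro x
    set e := chartAt E x
    set e' := chartAt E (F x)
    have he : e ∈ atlas E M := chart_mem_atlas E x
    have he' : e' ∈ atlas E M := chart_mem_atlas E (F x)
    have hxs : x ∈ e.source := mem_chart_source E x
    have hx : e x ∈ e.target := mem_chart_target E x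
    have hFx : F (e.symm (e x)) ∈ e'.source := by
      rw [e.left_inv hxs]
      exact mem_chart_source E (F x)
    have hG : ContDiffAt ℂ ω (e' ∘ F ∘ e.symm) (e x) :=
      ((contMDiffAt_of_mem_atlas he' hFx).comp (e x)
        (hF.contMDiffAt.comp (e x) (contMDiffAt_symm_of_mem_atlas he hx))).contDiffAt
    have hdet : ContDiffAt ℂ ω
        (fun y => LinearMap.det (fderiv ℂ (e' ∘ F ∘ e.symm) y).toLinearMap) (e x) :=
      contDiff_det.contDiffAt.comp (e x) (hG.fderiv_right (m := ω) (by simp))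
    have hs : ContDiffAt ℂ ω (canonicalCoeff e σ) (e x) :=
      (hσ e he).contDiffAt (e.open_target.mem_nhds hx)
    have hs' : ContDiffAt ℂ ω (fun y => canonicalCoeff e' σ ((e' ∘ F ∘ e.symm) y)) (e x) :=
      ContDiffAt.comp (g := canonicalCoeff e' σ) (e x)
        ((hσ e' he').contDiffAt (e'.open_target.mem_nhds (e'.map_source hFx))) hG
    have hq := ((hs'.mul hdet).div hs (canonicalCoeff_ne_zero hσ0 he hx)).differentiableAt
      (by simp)
    have hcomp := hq.mdifferentiableAt.comp x (mdifferentiableAt_of_mem_atlas he hxs)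
    refine hcomp.congr_of_eventuallyEq ?_
    have hev : ∀ᶠ z in 𝓝 x, F z ∈ e'.source := hFd.continuous.continuousAt.eventually
      (e'.open_source.eventually_mem (mem_chart_source E (F x)))
    filter_upwards [e.open_source.eventually_mem hxs, hev] with z hz hz'
    have hzt := e.map_source hz
    have h := ScalesAt.canonicalCoeff (σ := σ) (F := F) (μ := ratio z) (y := e z) he he' hzt
      (by rwa [e.left_inv hz]) (hFd _) (by rw [e.left_inv hz]; exact hscale z)
    rw [Function.comp_apply, Pi.div_apply,
      eq_div_iff (canonicalCoeff_ne_zero hσ0 he hzt)]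
    exact h.symm
  obtain ⟨μ, hμ⟩ := hdiff.exists_eq_const_of_compactSpace
  refine ⟨μ, fun x => ?_⟩
  have := hscale x
  rwa [hμ] at this

theorem exists_closedBall_subset_chart_target (x : M) :
    ∃ r : ℝ, 0 < r ∧ Metric.closedBall (chartAt E x x) r ⊆ (chartAt E x).target :=
  Metric.nhds_basis_closedBall.mem_iff.1
    ((chartAt E x).open_target.mem_nhds (mem_chart_target E x))

/-- Since `F` is onto, the images of finitely many chart balls cover a fixed ball `B x₀`. In charts
the Jacobian of `F` is `μ` times a ratio of coefficients of `σ`, bounded independently of `F`.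
Comparing volumes gives `vol (B x₀) ≤ |μ|² D`, with `D` depending only on `σ` and the chosen balls.
-/
theorem exists_pos_le_normSq_of_scalesAt [CompactSpace M] [T2Space M] [Nonempty M]
    {σ : M → CanonicalFiber E}
    (hσ : ∀ e ∈ atlas E M, ContDiffOn ℂ ω (canonicalCoeff e σ) e.target) (hσ0 : ∀ x, σ x ≠ 0) :
    ∃ C : ℝ, 0 < C ∧ ∀ (F : M → M) (μ : ℂ), MDifferentiable 𝓘(ℂ, E) 𝓘(ℂ, E) F →
      Function.Surjective F → (∀ x, ScalesAt σ F μ x) → C ≤ Complex.normSq μ := by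
  classical
  let _ : MeasurableSpace E := borel E
  have : BorelSpace E := ⟨rfl⟩
  have : ProperSpace E := FiniteDimensional.proper_rclike ℂ E
  obtain ⟨vol, hvol⟩ : ∃ vol : Measure E, vol.IsAddHaarMeasure := ⟨Measure.addHaar, inferInstance⟩
  choose r hr hball using fun x : M => exists_closedBall_subset_chart_target (E := E) x
  let B : M → Set E := fun x => Metric.closedBall (chartAt E x x) (r x)
  have hBc : ∀ x, IsCompact (B x) := fun x => isCompact_closedBall _ _
  have hcont : ∀ x, ContinuousOn (canonicalCoeff (chartAt E x) σ) (B x) := fun x =>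
    (hσ _ (chart_mem_atlas E x)).continuousOn.mono (hball x)
  choose C hC using fun x => (hBc x).exists_bound_of_continuousOn (hcont x)
  obtain ⟨t, ht⟩ := CompactSpace.elim_nhds_subcover
    (fun x => (chartAt E x).source ∩ chartAt E x ⁻¹' Metric.ball (chartAt E x x) (r x))
    (fun x => Filter.inter_mem ((chartAt E x).open_source.mem_nhds (mem_chart_source E x))
      (((chartAt E x).continuousAt (mem_chart_source E x)).preimage_mem_nhds
        (Metric.ball_mem_nhds _ (hr x))))
  obtain ⟨x₀⟩ := ‹Nonempty M›
  set c₀ := chartAt E x₀ with hc₀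
  have hB₀ : (B x₀).Nonempty := ⟨_, Metric.mem_closedBall_self (hr x₀).le⟩
  obtain ⟨y₀, hy₀, hmin⟩ := (hBc x₀).exists_isMinOn hB₀ (hcont x₀).norm
  set m := ‖canonicalCoeff c₀ σ y₀‖ with hm
  have hmpos : 0 < m :=
    norm_pos_iff.2 (canonicalCoeff_ne_zero hσ0 (chart_mem_atlas E x₀) (hball x₀ hy₀))
  have hK₀ : IsClosed (c₀.symm '' B x₀) :=
    ((hBc x₀).image_of_continuousOn (c₀.symm.continuousOn.mono (hball x₀))).isClosed
  obtain ⟨D, hDdef⟩ : ∃ D : ℝ, D = ∑ x ∈ t, C x ^ 2 / m ^ 2 * (vol (B x)).toReal := ⟨_, rfl⟩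
  have hD : 0 ≤ D := hDdef ▸ Finset.sum_nonneg fun x _ =>
    mul_nonneg (div_nonneg (sq_nonneg _) (sq_nonneg _)) ENNReal.toReal_nonneg
  have hD1 : 0 < D + 1 := by linarith
  have hv : 0 < (vol (B x₀)).toReal :=
    ENNReal.toReal_pos (Metric.measure_closedBall_pos vol _ (hr x₀)).ne' (hBc x₀).measure_ne_top
  -- Using `D + 1` in place of `D` avoids having to show that `D` is nonzero.
  refine ⟨(vol (B x₀)).toReal / (D + 1), div_pos hv hD1, fun F μ hF hsurj hscale => ?_⟩
  -- `S x` is the part of `B x` that `F` sends into the fixed ball, and `G x` is `F` read in the two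
  -- charts.
  let S : M → Set E := fun x => B x ∩ (F ∘ (chartAt E x).symm) ⁻¹' (c₀.symm '' B x₀)
  let G : M → E → E := fun x => c₀ ∘ F ∘ (chartAt E x).symm
  have hSmeas : ∀ x, MeasurableSet (S x) := fun x =>
    (ContinuousOn.preimage_isClosed_of_isClosed (hF.continuous.comp_continuousOn
      ((chartAt E x).symm.continuousOn.mono (hball x))) (hBc x).isClosed hK₀).measurableSet
  have hSmem : ∀ x, ∀ y ∈ S x, F ((chartAt E x).symm y) ∈ c₀.source ∧ G x y ∈ B x₀ := by
    rintro x y ⟨-, z, hz, hzF⟩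
    change F ((chartAt E x).symm y) ∈ c₀.source ∧ c₀ (F ((chartAt E x).symm y)) ∈ B x₀
    rw [← show c₀.symm z = F ((chartAt E x).symm y) from hzF, c₀.right_inv (hball x₀ hz)]
    exact ⟨c₀.map_target (hball x₀ hz), hz⟩
  have hcover : B x₀ ⊆ ⋃ x ∈ t, G x '' S x := by
    intro z hz
    obtain ⟨w, hw⟩ := hsurj (c₀.symm z)
    have hwt : w ∈ ⋃ x ∈ t, (chartAt E x).source ∩
        chartAt E x ⁻¹' Metric.ball (chartAt E x x) (r x) := by
      rw [ht]
      trivial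
    obtain ⟨x, hx, hws, hwb⟩ := Set.mem_iUnion₂.1 hwt
    refine Set.mem_iUnion₂.2 ⟨x, hx, chartAt E x w, ⟨Metric.ball_subset_closedBall hwb, z, hz, ?_⟩,
      ?_⟩
    · rw [Function.comp_apply, (chartAt E x).left_inv hws, hw]
    · change c₀ (F ((chartAt E x).symm (chartAt E x w))) = z
      rw [(chartAt E x).left_inv hws, hw, c₀.right_inv (hball x₀ hz)]
  have hpiece : ∀ x, vol (G x '' S x) ≤
      ENNReal.ofReal (Complex.normSq μ * (C x ^ 2 / m ^ 2)) * vol (B x) := by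
    intro x
    have hderiv : ∀ y ∈ S x, HasFDerivWithinAt (G x) ((fderiv ℂ (G x) y).restrictScalars ℝ)
        (S x) y := by
      intro y hy
      have h1 : MDifferentiableAt 𝓘(ℂ, E) 𝓘(ℂ, E) (G x) y :=
        (mdifferentiableAt_of_mem_atlas (chart_mem_atlas E x₀) (hSmem x y hy).1).comp y
          ((hF _).comp y (mdifferentiableAt_symm_of_mem_atlas (chart_mem_atlas E x)
            (hball x hy.1)))
      exact (h1.differentiableAt.hasFDerivAt.restrictScalars ℝ).hasFDerivWithinAt
    -- Only an upper bound for the volume of the image is needed, so injectivity plays no role.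
    refine (addHaar_image_le_lintegral_abs_det_fderiv vol (hSmeas x) hderiv).trans ?_
    refine (setLIntegral_mono' (hSmeas x) (g := fun _ =>
      ENNReal.ofReal (Complex.normSq μ * (C x ^ 2 / m ^ 2))) fun y hy => ?_).trans ?_
    · refine ENNReal.ofReal_le_ofReal ?_
      rw [abs_det_restrictScalars, Complex.normSq_eq_norm_sq, Complex.normSq_eq_norm_sq,
        ← mul_div_assoc, ← mul_pow, le_div_iff₀ (by positivity), ← mul_pow]
      refine pow_le_pow_left₀ (mul_nonneg (norm_nonneg _) hmpos.le) ?_ 2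
      have h := congrArg norm (ScalesAt.canonicalCoeff (chart_mem_atlas E x)
        (chart_mem_atlas E x₀) (hball x hy.1) (hSmem x y hy).1 (hF _) (hscale _))
      rw [norm_mul, norm_mul] at h
      calc _ ≤ ‖LinearMap.det (fderiv ℂ (G x) y).toLinearMap‖ *
            ‖canonicalCoeff c₀ σ (G x y)‖ :=
            mul_le_mul_of_nonneg_left (hmin (hSmem x y hy).2) (norm_nonneg _)
        _ = ‖μ‖ * ‖canonicalCoeff (chartAt E x) σ y‖ := by rw [mul_comm]; exact h
        _ ≤ ‖μ‖ * C x := mul_le_mul_of_nonneg_left (hC x y hy.1) (norm_nonneg _)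
    · rw [setLIntegral_const]
      gcongr
      exact Set.inter_subset_left
  have htotal : vol (B x₀) ≤ ∑ x ∈ t,
      ENNReal.ofReal (Complex.normSq μ * (C x ^ 2 / m ^ 2)) * vol (B x) :=
    (measure_mono hcover).trans ((measure_biUnion_finset_le t _).trans
      (Finset.sum_le_sum fun x _ => hpiece x))
  have hfin : ∀ x ∈ t,
      ENNReal.ofReal (Complex.normSq μ * (C x ^ 2 / m ^ 2)) * vol (B x) ≠ ⊤ := fun x _ =>
    ENNReal.mul_ne_top ENNReal.ofReal_ne_top (hBc x).measure_ne_top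
  have hreal := ENNReal.toReal_mono (ENNReal.sum_ne_top.2 hfin) htotal
  rw [ENNReal.toReal_sum hfin] at hreal
  have hsum : ∑ x ∈ t, (ENNReal.ofReal (Complex.normSq μ * (C x ^ 2 / m ^ 2)) * vol (B x)).toReal =
      Complex.normSq μ * D := by
    rw [hDdef, Finset.mul_sum]
    refine Finset.sum_congr rfl fun x _ => ?_
    rw [ENNReal.toReal_mul, ENNReal.toReal_ofReal
      (mul_nonneg (Complex.normSq_nonneg _) (div_nonneg (sq_nonneg _) (sq_nonneg _))), mul_assoc]
  rw [hsum] at hreal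
  rw [div_le_iff₀ hD1]
  exact hreal.trans (mul_le_mul_of_nonneg_left (by linarith) (Complex.normSq_nonneg _))

theorem ScalesAt.iterate {σ : M → CanonicalFiber E} {F : M → M} {μ : ℂ}
    (hF : ContMDiff 𝓘(ℂ, E) 𝓘(ℂ, E) ω F) (hμ : ∀ x, ScalesAt σ F μ x) (n : ℕ) (x : M) :
    ScalesAt σ F^[n] (μ ^ n) x := by
  induction n generalizing x with
  | zero => rw [ScalesAt, Function.iterate_zero, jacobian_id, pow_zero, id]
  | succ n ih =>
    rw [Function.iterate_succ, pow_succ]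
    exact ScalesAt.comp (hF.mdifferentiable (by simp) x)
      ((hF.iterate n).mdifferentiable (by simp) _) (hμ x) (ih _)

/-- If `|μ| < 1`, the factors `μ ^ n` of the iterates would fall below the uniform bound. The
inverse has factor `μ⁻¹`, which excludes `|μ| > 1` in the same way. -/
theorem normSq_eq_one_of_scalesAt [CompactSpace M] [T2Space M] [ConnectedSpace M]
    {σ : M → CanonicalFiber E}
    (hσ : ∀ e ∈ atlas E M, ContDiffOn ℂ ω (canonicalCoeff e σ) e.target) (hσ0 : ∀ x, σ x ≠ 0)
    (f : M ≃ₘ^ω⟮𝓘(ℂ, E), 𝓘(ℂ, E)⟯ M) {μ : ℂ} (hμ : ∀ x, ScalesAt σ f μ x) :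
    Complex.normSq μ = 1 := by
  obtain ⟨C, hC, hle⟩ := exists_pos_le_normSq_of_scalesAt hσ hσ0
  have key : ∀ (g : M ≃ₘ^ω⟮𝓘(ℂ, E), 𝓘(ℂ, E)⟯ M) (ν : ℂ), (∀ x, ScalesAt σ g ν x) →
      1 ≤ Complex.normSq ν := by
    intro g ν hν
    by_contra! hlt
    obtain ⟨n, hn⟩ := exists_pow_lt_of_lt_one hC hlt
    rw [← map_pow] at hn
    exact hn.not_ge (hle _ _ ((g.contMDiff.iterate n).mdifferentiable (by simp))
      (g.surjective.iterate n) (ScalesAt.iterate g.contMDiff hν n))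
  obtain ⟨ν, hν⟩ := exists_scalesAt_of_compactSpace hσ hσ0 f.symm.contMDiff
  obtain ⟨x⟩ : Nonempty M := inferInstance
  have h1 := ScalesAt.comp (f.contMDiff.mdifferentiable (by simp) x)
    (f.symm.contMDiff.mdifferentiable (by simp) _) (hμ x) (hν _)
  have h2 : (f.symm ∘ f : M → M) = id := funext f.symm_apply_apply
  rw [h2, ScalesAt, jacobian_id, id] at h1
  have h3 : ν * μ = 1 := (mul_right_cancel₀ (pointCoeff_ne_zero (hσ0 x)) h1).symm
  have h4 : Complex.normSq ν * Complex.normSq μ = 1 := by rw [← map_mul, h3, map_one]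
  nlinarith [key f μ hμ, key f.symm ν hν]

/-- For a nowhere vanishing holomorphic canonical form `σ` on a compact connected manifold, `|σ|²`
is invariant under automorphisms. -/
theorem normSq_jacobian_mul_pointCoeff [CompactSpace M] [T2Space M] [ConnectedSpace M]
    {σ : M → CanonicalFiber E}
    (hσ : ∀ e ∈ atlas E M, ContDiffOn ℂ ω (canonicalCoeff e σ) e.target) (hσ0 : ∀ x, σ x ≠ 0)
    (f : M ≃ₘ^ω⟮𝓘(ℂ, E), 𝓘(ℂ, E)⟯ M) (x : M) :
    Complex.normSq (jacobian E f x) * Complex.normSq (pointCoeff σ (f x)) =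
      Complex.normSq (pointCoeff σ x) := by
  obtain ⟨μ, hμ⟩ := exists_scalesAt_of_compactSpace hσ hσ0 f.contMDiff
  rw [← map_mul, hμ x, map_mul, normSq_eq_one_of_scalesAt hσ hσ0 f hμ, one_mul]

end VolumePreserving

/-! ## Descent of densities to quotients -/

section QuotientDensity

open AddAction (orbitRel)

variable {E : Type*} [NormedAddCommGroup E] [NormedSpace ℂ E]
variable {N G : Type*} [TopologicalSpace N] [T2Space N] [LocallyCompactSpace N] [ChartedSpace E N]
  [IsManifold 𝓘(ℂ, E) ω N] [AddGroup G] [AddAction G N] [ProperlyDiscontinuousVAdd G N]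
  [ContinuousConstVAdd G N] [IsCancelVAdd G N]

theorem exists_eq_trans_of_mem_atlas_quotient {e : OpenPartialHomeomorph (orbitRel.Quotient G N) E}
    (he : e ∈ atlas E (orbitRel.Quotient G N)) :
    ∃ (l : OpenPartialHomeomorph (orbitRel.Quotient G N) N) (p : N),
      l.symm = (Quotient.mk _ : N → orbitRel.Quotient G N) ∧ e = l ≫ₕ chartAt E p := by
  have hcov := isAddQuotientCoveringMap_quotientMk_of_properlyDiscontinuousVAdd (E := N) (G := G)
  have hloc := hcov.isCoveringMap.isLocalHomeomorph
  obtain ⟨a, rfl⟩ := he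
  exact ⟨_, _, hloc.localInverseAt_symm _, rfl⟩

/-- A local section of the covering composed with the quotient map is locally the action of one
group element, so the quotient map read in charts is a translate followed by a chart of `N`. -/
theorem mdifferentiable_quotientMk
    (hG : ∀ g : G, ContMDiff 𝓘(ℂ, E) 𝓘(ℂ, E) ω (fun p : N => g +ᵥ p)) :
    MDifferentiable 𝓘(ℂ, E) 𝓘(ℂ, E) (Quotient.mk _ : N → orbitRel.Quotient G N) := by
  intro p
  have hmfd : IsManifold 𝓘(ℂ, E) ω (orbitRel.Quotient G N) := quotient_isManifold hG
  have hcov := isAddQuotientCoveringMap_quotientMk_of_properlyDiscontinuousVAdd (E := N) (G := G)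
  set q : N → orbitRel.Quotient G N := Quotient.mk _ with hq
  have hqc : Continuous q := hcov.isCoveringMap.continuous
  set e := chartAt E (q p) with hedef
  have he : e ∈ atlas E (orbitRel.Quotient G N) := chart_mem_atlas E (q p)
  have hes : q p ∈ e.source := mem_chart_source E (q p)
  obtain ⟨l, p', hl, hel⟩ := exists_eq_trans_of_mem_atlas_quotient he
  have hes' := hes
  rw [hel, OpenPartialHomeomorph.trans_source] at hes'
  obtain ⟨g, hg⟩ := eventually_section_eq_vadd hcov l hl p hes'.1
  have hgp : g +ᵥ p ∈ (chartAt E p').source := hg.self_of_nhds ▸ hes'.2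
  have heq : e (q p) = chartAt E p' (g +ᵥ p) := by
    rw [hel, ← hg.self_of_nhds]
    rfl
  have h1 : MDifferentiableAt 𝓘(ℂ, E) 𝓘(ℂ, E) (chartAt E p' ∘ fun x => g +ᵥ x) p :=
    (mdifferentiableAt_of_mem_atlas (chart_mem_atlas E p') hgp).comp p
      ((hG g).mdifferentiable (by simp) p)
  have h2 : MDifferentiableAt 𝓘(ℂ, E) 𝓘(ℂ, E) e.symm ((chartAt E p' ∘ fun x => g +ᵥ x) p) :=
    mdifferentiableAt_symm_of_mem_atlas he (heq.subst (motive := (· ∈ e.target)) (e.map_source hes))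
  refine (h2.comp p h1).congr_of_eventuallyEq ?_
  filter_upwards [hg, hqc.continuousAt.eventually (e.open_source.eventually_mem hes)] with x hx hxs
  rw [Function.comp_apply, Function.comp_apply, ← hx]
  conv_lhs => rw [← e.left_inv hxs]
  congr 1
  rw [hel]
  rfl

variable [FiniteDimensional ℂ E]

/-- The density is pushed forward from an arbitrary representative of each orbit; invariance removes
the dependence on the choice. Charts of the quotient are charts of `N` composed with local sections,
so the local holomorphic functions upstairs also serve downstairs. -/
theorem exists_density_quotient
    (hG : ∀ g : G, ContMDiff 𝓘(ℂ, E) 𝓘(ℂ, E) ω (fun p : N => g +ᵥ p)) {w : N → ℝ}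
    (hw : HasHolomorphicDensity (E := E) w)
    (hinv : ∀ (g : G) (p : N),
      Complex.normSq (jacobian E (fun x : N => g +ᵥ x) p) * w p = w (g +ᵥ p)) :
    ∃ w' : orbitRel.Quotient G N → ℝ, HasHolomorphicDensity (E := E) w' ∧
      ∀ p, Complex.normSq (jacobian E (Quotient.mk _ : N → orbitRel.Quotient G N) p) * w p =
        w' (Quotient.mk _ p) := by
  have hmfd : IsManifold 𝓘(ℂ, E) ω (orbitRel.Quotient G N) := quotient_isManifold hG
  have hcov := isAddQuotientCoveringMap_quotientMk_of_properlyDiscontinuousVAdd (E := N) (G := G)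
  set q : N → orbitRel.Quotient G N := Quotient.mk _ with hq
  have hqd : MDifferentiable 𝓘(ℂ, E) 𝓘(ℂ, E) q := mdifferentiable_quotientMk hG
  have hdesc : ∀ p, Complex.normSq (jacobian E q p) * w p =
      Complex.normSq (jacobian E q (q p).out) * w (q p).out := by
    intro p
    obtain ⟨g, hg⟩ := hcov.apply_eq_iff_mem_orbit.mp ((Quotient.out_eq (q p)).symm)
    have hg : g +ᵥ (q p).out = p := hg
    have hcomp : q ∘ (fun x : N => g +ᵥ x) = q := by
      funext x
      exact hcov.apply_eq_iff_mem_orbit.mpr ⟨g, rfl⟩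
    -- The chain rule for `q ∘ (g +ᵥ ·) = q` compares the Jacobians of `q` at two points of an
    -- orbit.
    have hj := jacobian_comp (hqd (g +ᵥ (q p).out)) ((hG g).mdifferentiable (by simp) (q p).out)
    rw [hcomp, hg] at hj
    rw [hj, map_mul, mul_assoc, hinv, hg]
  refine ⟨fun x => Complex.normSq (jacobian E q x.out) * w x.out, ?_, hdesc⟩
  intro e he y hy
  obtain ⟨l, p', hl, hel⟩ := exists_eq_trans_of_mem_atlas_quotient he
  set c := chartAt E p' with hc
  have hyt : ∀ z ∈ e.target, z ∈ c.target ∧ c.symm z ∈ l.target ∧ e.symm z = q (c.symm z) := by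
    intro z hz
    have hz' := hz
    rw [hel, OpenPartialHomeomorph.trans_target] at hz'
    refine ⟨hz'.1, hz'.2, ?_⟩
    rw [hel, hq, ← hl]
    rfl
  obtain ⟨g, hg, hg0, hgw⟩ := hw c (chart_mem_atlas E p') y (hyt y hy).1
  refine ⟨g, hg, hg0, ?_⟩
  filter_upwards [hgw, e.open_target.eventually_mem hy] with z hz hze
  obtain ⟨hzc, hzl, hzq⟩ := hyt z hze
  have hes : q (c.symm z) ∈ e.source := hzq ▸ e.map_target hze
  have hj := jacobian_comp (mdifferentiableAt_of_mem_atlas he hes) (hqd (c.symm z))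
  -- The section `l` inverts `q` here, so the Jacobian of `e` times that of `q` is the Jacobian of
  -- `c`.
  have hcongr : e ∘ q =ᶠ[𝓝 (c.symm z)] c := by
    filter_upwards [l.open_target.eventually_mem hzl] with x hx
    have hlx : l (q x) = x := by
      rw [hq, ← hl]
      exact l.right_inv hx
    rw [Function.comp_apply, hel, OpenPartialHomeomorph.coe_trans, Function.comp_apply, hlx]
  rw [jacobian_congr hcongr] at hj
  rw [← hz, hj, map_mul, hzq, ← hdesc, mul_assoc]

end QuotientDensity

/-! ## The flat metric on the canonical bundle of the suspension -/

section SuspensionMetric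

variable {E : Type*} [NormedAddCommGroup E] [NormedSpace ℂ E]
variable {M : Type*} [TopologicalSpace M] [ChartedSpace E M]
variable {V : Type*} [NormedAddCommGroup V] [NormedSpace ℂ V]
variable {Γ : Submodule ℤ V} {ι : Type*}
variable (f : M ≃ₘ^ω⟮𝓘(ℂ, E), 𝓘(ℂ, E)⟯ M) (b : Module.Basis ι ℤ Γ)

theorem hasMFDerivAt_suspension_prodMap {F : M → M} {S : V → V} {A : E →L[ℂ] E} {B : V →L[ℂ] V}
    {p : SuspensionCover f b} (hF : HasMFDerivAt 𝓘(ℂ, E) 𝓘(ℂ, E) F p.1 A)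
    (hS : HasFDerivAt S B p.2) :
    HasMFDerivAt (M := SuspensionCover f b) (M' := SuspensionCover f b) 𝓘(ℂ, E × V) 𝓘(ℂ, E × V)
      (Prod.map F S) p (A.prodMap B : E × V →L[ℂ] E × V) := by
  rw [modelWithCornersSelf_prod]
  have h := HasMFDerivAt.prodMap (p := (p : M × V)) hF hS.hasMFDerivAt
  rw [hF.mfderiv, hS.hasMFDerivAt.mfderiv] at h
  exact h

theorem hasMFDerivAt_suspension_chart {F : M → E} {A : E →L[ℂ] E}
    {p : SuspensionCover f b} (hF : HasMFDerivAt 𝓘(ℂ, E) 𝓘(ℂ, E) F p.1 A) :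
    HasMFDerivAt (M := SuspensionCover f b) (M' := E × V) 𝓘(ℂ, E × V) 𝓘(ℂ, E × V)
      (Prod.map F id) p
      (A.prodMap (ContinuousLinearMap.id ℂ V) : E × V →L[ℂ] E × V) := by
  rw [modelWithCornersSelf_prod, ← chartedSpaceSelf_prod]
  have h := HasMFDerivAt.prodMap (p := (p : M × V)) hF (hasFDerivAt_id (𝕜 := ℂ) p.2).hasMFDerivAt
  rw [hF.mfderiv, (hasFDerivAt_id (𝕜 := ℂ) p.2).hasMFDerivAt.mfderiv] at h
  exact h

variable [FiniteDimensional ℂ E] [FiniteDimensional ℂ V]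

theorem det_prodMap_id (A : E →L[ℂ] E) :
    LinearMap.det (A.prodMap (ContinuousLinearMap.id ℂ V)).toLinearMap =
      LinearMap.det A.toLinearMap := by
  refine (LinearMap.det_prodMap A.toLinearMap (LinearMap.id : V →ₗ[ℂ] V)).trans ?_
  rw [LinearMap.det_id, mul_one]

variable [IsManifold 𝓘(ℂ, E) ω M]

theorem jacobian_suspension_vadd (γ : Γ) (p : SuspensionCover f b) :
    jacobian (E × V) (fun x : SuspensionCover f b => γ +ᵥ x) p =
      jacobian E (monodromy f b γ) p.1 := by
  have h := hasMFDerivAt_suspension_prodMap f b (p := p)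
    ((contMDiff_monodromy f b γ).mdifferentiable (by simp) p.1).hasMFDerivAt
    ((hasFDerivAt_id (𝕜 := ℂ) p.2).add_const (γ : V))
  have h' : mfderiv 𝓘(ℂ, E × V) 𝓘(ℂ, E × V) (fun x : SuspensionCover f b => γ +ᵥ x) p = _ :=
    h.mfderiv
  unfold jacobian
  rw [h']
  exact det_prodMap_id _

theorem jacobian_suspension_chart {e : OpenPartialHomeomorph M E} (he : e ∈ atlas E M)
    {p : SuspensionCover f b} (hp : p.1 ∈ e.source) :
    jacobian (X := SuspensionCover f b) (Y := E × V) (E × V) (Prod.map e id) p = jacobian E e p.1 := by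
  have h := hasMFDerivAt_suspension_chart f b (p := p)
    (mdifferentiableAt_of_mem_atlas he hp).hasMFDerivAt
  unfold jacobian
  rw [h.mfderiv]
  exact det_prodMap_id _

/-- The squared norm of the standard volume form of `E × V` for the metric on the canonical bundle
of `M × V` in which `σ ∧ dt` has norm one. -/
noncomputable def suspensionDensity (σ : M → CanonicalFiber E) (p : SuspensionCover f b) : ℝ :=
  (Complex.normSq (pointCoeff σ p.1))⁻¹

theorem hasHolomorphicDensity_suspensionDensity {σ : M → CanonicalFiber E}
    (hσ : ∀ e ∈ atlas E M, ContDiffOn ℂ ω (canonicalCoeff e σ) e.target) (hσ0 : ∀ x, σ x ≠ 0) :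
    HasHolomorphicDensity (E := E × V) (suspensionDensity f b σ) := by
  rintro _ ⟨e, he, e', he', rfl⟩ y hy
  obtain rfl : e' = OpenPartialHomeomorph.refl V := he'
  have hy1 : y.1 ∈ e.target := hy.1
  have hs : ContDiffAt ℂ ω (fun z : E × V => canonicalCoeff e σ z.1) y :=
    ContDiffAt.comp (g := canonicalCoeff e σ) y
      ((hσ e he).contDiffAt (e.open_target.mem_nhds hy1)) contDiffAt_fst
  have h0 : canonicalCoeff e σ y.1 ≠ 0 := canonicalCoeff_ne_zero hσ0 he hy1
  -- If `σ = s dz` in the chart and `σ ∧ dt` has norm one, then `dz ∧ dt` has squared norm `|1 /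
  -- s|²`.
  refine ⟨fun z => (canonicalCoeff e σ z.1)⁻¹, hs.inv h0, inv_ne_zero h0, ?_⟩
  filter_upwards [continuous_fst.continuousAt.eventually (e.open_target.eventually_mem hy1)]
    with z hz
  have hj := jacobian_suspension_chart f b he (p := (e.symm z.1, z.2)) (e.map_target hz)
  have hm := congrArg Complex.normSq (jacobian_chart_mul_symm he hz)
  rw [map_mul, map_one] at hm
  change Complex.normSq (jacobian (X := SuspensionCover f b) (Y := E × V) (E × V) (Prod.map e id)
    (e.symm z.1, z.2)) * (Complex.normSq (pointCoeff σ (e.symm z.1)))⁻¹ = _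
  rw [hj, canonicalCoeff_eq, map_inv₀, map_mul, mul_inv, eq_inv_of_mul_eq_one_left hm]
  rfl

/-- The automorphism of `M` by which an element of the lattice acts. -/
noncomputable def monodromyDiffeomorph (γ : Γ) : M ≃ₘ^ω⟮𝓘(ℂ, E), 𝓘(ℂ, E)⟯ M where
  toEquiv := monodromy f b γ
  contMDiff_toFun := contMDiff_monodromy f b γ
  contMDiff_invFun := by
    have h : (monodromy f b γ).symm = monodromy f b (-γ) := by
      rw [monodromy, monodromy, map_neg, zpow_neg]
      rfl
    rw [h]
    exact contMDiff_monodromy f b (-γ)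

/-- Translations of `V` have Jacobian one, so this is the invariance of `|σ|²` under the monodromy,
written for the reciprocal. -/
theorem suspensionDensity_vadd [CompactSpace M] [T2Space M] [ConnectedSpace M]
    {σ : M → CanonicalFiber E}
    (hσ : ∀ e ∈ atlas E M, ContDiffOn ℂ ω (canonicalCoeff e σ) e.target) (hσ0 : ∀ x, σ x ≠ 0)
    (γ : Γ) (p : SuspensionCover f b) :
    Complex.normSq (jacobian (E × V) (fun x : SuspensionCover f b => γ +ᵥ x) p) *
      suspensionDensity f b σ p = suspensionDensity f b σ (γ +ᵥ p) := by
  have h := normSq_jacobian_mul_pointCoeff hσ hσ0 (monodromyDiffeomorph f b γ) p.1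
  have h0 : Complex.normSq (pointCoeff σ p.1) ≠ 0 :=
    (Complex.normSq_pos.2 (pointCoeff_ne_zero (hσ0 _))).ne'
  have h1 : Complex.normSq (pointCoeff σ (γ +ᵥ p : SuspensionCover f b).1) ≠ 0 :=
    (Complex.normSq_pos.2 (pointCoeff_ne_zero (hσ0 _))).ne'
  change Complex.normSq (jacobian E (monodromy f b γ) p.1) *
    Complex.normSq (pointCoeff σ (γ +ᵥ p : SuspensionCover f b).1) = _ at h
  rw [jacobian_suspension_vadd, suspensionDensity, suspensionDensity, ← div_eq_mul_inv,
    div_eq_iff h0, ← h, mul_comm, mul_assoc, mul_inv_cancel₀ h1, mul_one]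

end SuspensionMetric

theorem mainTheorem4
    {E : Type*} [NormedAddCommGroup E] [NormedSpace ℂ E] [FiniteDimensional ℂ E]
    {M : Type*} [TopologicalSpace M] [ChartedSpace E M] [IsManifold 𝓘(ℂ, E) ω M]
    [T2Space M] [CompactSpace M] [SimplyConnectedSpace M]
    (hM : IsKaehler E M) (hK : HasTrivialCanonicalBundle E M)
    (f : M ≃ₘ^ω⟮𝓘(ℂ, E), 𝓘(ℂ, E)⟯ M) (hf : ¬ IsOfFinOrder (f.toEquiv : Equiv.Perm M))
    {V : Type*} [NormedAddCommGroup V] [NormedSpace ℂ V] [FiniteDimensional ℂ V]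
    (Γ : Submodule ℤ V) [DiscreteTopology Γ] [IsZLattice ℝ Γ]
    {ι : Type*} (b : Module.Basis ι ℤ Γ) :
    (∃ (h : CanonicalMetric (E × V) (Suspension f b))
        (h' : CanonicalMetric (E × V) (SuspensionCover f b)),
        h.IsFlat ∧ h'.IsFlat ∧
        h'.IsPullback (suspensionMk f b) h ∧
        ∀ γ : Γ, h'.IsPullback (fun p => γ +ᵥ p) h') ∧
      IsCanonicalChernClass (0 : DeRhamCohomology (E × V) (Suspension f b) 2) ∧
      HasCanonicalNumericalDimension (E × V) (Suspension f b) 0 := by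
  obtain ⟨σ, hσ, hσ0⟩ := hK
  have hw' := hasHolomorphicDensity_suspensionDensity f b hσ hσ0
  have hinv := suspensionDensity_vadd f b hσ hσ0
  obtain ⟨w, hw, hq⟩ := exists_density_quotient (contMDiff_suspension_vadd f b) hw' hinv
  have hflat := CanonicalMetric.ofDensity_isFlat hw
  obtain ⟨z⟩ : Nonempty M := inferInstance
  -- A point of `X` is needed for the class of `1` in degree `0` to be nonzero.
  have : Nonempty (Suspension f b) := ⟨suspensionMk f b (z, 0)⟩
  exact ⟨⟨.ofDensity w hw, .ofDensity _ hw', hflat, CanonicalMetric.ofDensity_isFlat hw',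
    CanonicalMetric.ofDensity_isPullback hw' hw hq,
    fun γ => CanonicalMetric.ofDensity_isPullback hw' hw' (hinv γ)⟩,
    hflat.isCanonicalChernClass_zero, hflat.hasCanonicalNumericalDimension_zero⟩
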